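/- For real $x\ge 3$ let $\mathbb{E}_{n\le x}$ denote the average over the positive integers $n\le x$, let $\omega(n)$ be the number of distinct prime divisors of $n$, and for integers $k\ge 0$ let \[ \mu_k=\mathbb{E}(G^k)\ \text{ with } G\sim N(0,1),\qquad M_k=\frac{k!}{2^{k/2}\,\Gamma(k/2+1)}. \] Let \[ a=\gamma+\sum_{p}\Big(\log\Big(1-\frac1p\Big)+\frac1p\Big) \] be the Meissel--Mertens constant, where $\gamma$ is the Euler--Mascheroni constant and $p$ runs over the primes. Proposition. Fix $A>0$. For all real $x\ge 3$, all integers $k$ with $1\le k\le A(\log\log x)^{1/3}$ and all real $T$ with $-A\le T\le A$, \[ \mathbb{E}_{n\le x}\bigg(\frac{\omega(n)-\log\log x-T}{\sqrt{\log\log x}}\bigg)^k=\mu_k+\bigg(\frac{k(k-1)}{6}+k(a-T)\bigg)\frac{\mu_{k-1}}{\sqrt{\log\log x}}+O_A\bigg(M_k\bigg(\frac{k^3}{\log\log x}\bigg)^{1+\frac{\mathbf 1_{2\nmid k}}{2}}\bigg), \] where $\mathbf 1_{2\nmid k}$ is $1$ if $k$ is odd and $0$ if $k$ is even, and the implied constant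 depends only on $A$. -/

import Mathlib

/-- The mean of `f` over the positive integers `n ≤ x`, each being equally likely. -/
noncomputable def meanUpTo (x : ℝ) (f : ℕ → ℝ) : ℝ :=
  (∑ n ∈ Finset.Icc 1 ⌊x⌋₊, f n) / (⌊x⌋₊ : ℝ)

/-- The series over the primes in the Meissel--Mertens constant converges absolutely. -/
theorem summable_meisselMertens_term :
    Summable fun p : Nat.Primes => Real.log (1 - 1 / (p : ℝ)) + 1 / (p : ℝ) := by
  have hs : Summable fun p : Nat.Primes => 2 * ((p : ℝ) ^ (-2 : ℝ)) :=
    (Nat.Primes.summable_rpow.2 (by norm_num)).mul_left 2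
  refine Summable.of_norm_bounded hs fun p => ?_
  have hp : (2 : ℝ) ≤ (p : ℝ) := by exact_mod_cast p.2.two_le
  have hp0 : (0 : ℝ) < (p : ℝ) := by linarith
  have hx0 : (0 : ℝ) < 1 / (p : ℝ) := by positivity
  have hx : 1 / (p : ℝ) ≤ 1 / 2 := one_div_le_one_div_of_le (by norm_num) hp
  have habs : |1 / (p : ℝ)| = 1 / (p : ℝ) := abs_of_pos hx0
  have h := Real.abs_log_sub_add_sum_range_le (x := 1 / (p : ℝ)) (by rw [habs]; linarith) 1
  rw [habs] at h
  simp only [Finset.sum_range_one, Nat.cast_zero, zero_add, pow_one, div_one] at h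
  rw [Real.norm_eq_abs, add_comm]
  refine h.trans ?_
  rw [Real.rpow_neg hp0.le, show (2 : ℝ) = ((2 : ℕ) : ℝ) by norm_num, Real.rpow_natCast,
    div_le_iff₀ (by linarith)]
  have : ((p : ℝ) ^ 2)⁻¹ = (1 / (p : ℝ)) ^ 2 := by field_simp
  rw [this]
  push_cast
  nlinarith [sq_nonneg (1 / (p : ℝ))]

/-- The Meissel--Mertens constant `γ + ∑_p (log (1 - 1/p) + 1/p)`. -/
noncomputable def meisselMertens : ℝ :=
  Real.eulerMascheroniConstant +
    ∑' p : Nat.Primes, (Real.log (1 - 1 / (p : ℝ)) + 1 / (p : ℝ))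

/-- The `k`-th moment `μ_k` of the standard Gaussian distribution. -/
noncomputable def gaussianMoment (k : ℕ) : ℝ :=
  ∫ t, t ^ k ∂(ProbabilityTheory.gaussianReal 0 1)

/-- `M_k = k! / (2 ^ (k / 2) Γ(k / 2 + 1))`. -/
noncomputable def momentScale (k : ℕ) : ℝ :=
  (k.factorial : ℝ) / ((2 : ℝ) ^ ((k : ℝ) / 2) * Real.Gamma ((k : ℝ) / 2 + 1))

open Finset

/-! Write L = log log x. The function ω behaves like a Poisson variable of mean L: the mean of
exp(u(ω(n) - T)) equals exp(L(e^u - 1)) R(u), where R = `normalizedGenFun x T` is entire and bounded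
on |u| ≤ 1/8, uniformly in x ≥ 3 and |T| ≤ A (`exists_norm_normalizedGenFun_le`). By Cauchy, the
Taylor coefficients of R at 0 are bounded too. Here R(0) = 1, and R'(0) = mean(ω) - L - T is a - T +
O(1/log x) by Mertens' theorem with its constant identified.

Put u = εs with ε = L^(-1/2). The generating function of the normalized moments becomes e^(s²/2)
exp(L(e^u - 1 - u - u²/2)) R(u). On the circle |s| = 2√(2k), with τ² = k³/L, the last two factors
multiply to 1 + ε(s³/6 + R'(0)s) + P(s) + O(τ³), where P = O(τ²) is even in s
(`exists_generatingFunction_expansion`). The k-th derivative at 0 turns 1, s³ and s, each times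
e^(s²/2), into μ_k, k(k-1)μ_(k-1) and kμ_(k-1). The rest is controlled by
`norm_iteratedDeriv_cexp_mul_le`: a bound S on the circle costs at most 2M_k S after multiplication
by e^(s²/2). For odd k the even term P contributes nothing, whence the error τ³ instead of τ².

The boundedness of R amounts to mean((1+w)^ω) ≪ (log x)^(Re w) for |w| ≤ 1/4. Expanding (1+w)^ω over
squarefree divisors reduces this to sums of w^ω(d)/d, which satisfy an approximate first-order
differential equation in log x, solved by an integrating factor
(`exists_norm_sum_squarefreeUpTo_div_le`). Bounded L is treated by crude estimates. -/

/-! ### Mertens' theorems, with an unspecified constant -/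

theorem exists_sum_log_div_mul_pred_le :
    ∃ C : ℝ, 0 < C ∧ ∀ s : Finset ℕ, (∀ p ∈ s, 2 ≤ p) →
      ∑ p ∈ s, Real.log p / ((p : ℝ) * (p - 1)) ≤ C := by
  -- The majorant comes from log p ≤ 2√p and p(p - 1) ≥ p²/2.
  have hs : Summable fun n : ℕ => 4 * (n : ℝ) ^ (-(3 / 2) : ℝ) :=
    (Real.summable_nat_rpow.2 (by norm_num)).mul_left 4
  refine ⟨∑' n : ℕ, 4 * (n : ℝ) ^ (-(3 / 2) : ℝ) + 1,
    add_pos_of_nonneg_of_pos (tsum_nonneg fun n => by positivity) one_pos, fun s h => ?_⟩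
  refine le_trans ((sum_le_sum fun p hp => ?_).trans
    (hs.sum_le_tsum s fun n _ => by positivity)) (by linarith)
  have hp2 : (2 : ℝ) ≤ p := by exact_mod_cast h p hp
  have hp0 : (0 : ℝ) < p := by linarith
  have hlog := Real.log_le_rpow_div hp0.le (show (0 : ℝ) < 1 / 2 by norm_num)
  rw [div_le_iff₀ (by nlinarith)]
  have e : (p : ℝ) ^ (1 / 2 : ℝ) = (p : ℝ) ^ (-(3 / 2) : ℝ) * (p : ℝ) ^ 2 := by
    rw [← Real.rpow_natCast, ← Real.rpow_add hp0]; norm_num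
  rw [e] at hlog
  have : 0 ≤ (p : ℝ) ^ (-(3 / 2) : ℝ) := by positivity
  nlinarith [mul_nonneg this (show 0 ≤ (p : ℝ) * (p - 2) by nlinarith)]

theorem log_factorial_eq_sum (N : ℕ) :
    Real.log (N.factorial) = ∑ p ∈ N.primesLE, (N.factorial.factorization p : ℝ) * Real.log p := by
  have h : N.factorial = ∏ p ∈ N.primesLE, p ^ N.factorial.factorization p := by
    conv_lhs => rw [← Nat.prod_factorization_pow_eq_self N.factorial_ne_zero]
    refine Finsupp.prod_of_support_subset _ (fun p hp => ?_) _ (fun p _ => pow_zero p)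
    rw [Nat.support_factorization] at hp
    have := Nat.prime_of_mem_primeFactors hp
    exact Nat.mem_primesLE.2 ⟨(this.dvd_factorial).1 (Nat.dvd_of_mem_primeFactors hp), this⟩
  conv_lhs => rw [h]
  push_cast
  rw [Real.log_prod]
  · exact sum_congr rfl fun p _ => Real.log_pow _ _
  · intro p hp
    have := (Nat.mem_primesLE.1 hp).2.pos
    positivity

theorem factorization_factorial_le {p N : ℕ} (hp : p.Prime) :
    (N.factorial.factorization p : ℝ) * ((p : ℝ) - 1) ≤ N := by
  have := Fact.mk hp
  have h := sub_one_mul_padicValNat_factorial (p := p) N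
  rw [← Nat.factorization_def _ hp] at h
  have h2 : (p - 1) * N.factorial.factorization p ≤ N := h ▸ Nat.sub_le _ _
  have h3 : (((p - 1 : ℕ) : ℝ)) * N.factorial.factorization p ≤ N := by exact_mod_cast h2
  rw [Nat.cast_sub hp.one_le] at h3
  push_cast at h3
  linarith

theorem le_factorization_factorial {p N : ℕ} (hp : p.Prime) :
    (N : ℝ) / p - 1 ≤ N.factorial.factorization p := by
  have h : N / p ≤ N.factorial.factorization p := by
    rw [Nat.factorization_factorial hp (b := Nat.log p N + 2) (by omega)]
    refine le_trans (by simp) (single_le_sum (f := fun i => N / p ^ i) (fun _ _ => Nat.zero_le _)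
      (show 1 ∈ Ico 1 (Nat.log p N + 2) by simp))
  have h1 : (N : ℝ) / p < ((N / p : ℕ) : ℝ) + 1 := by
    rw [div_lt_iff₀ (by exact_mod_cast hp.pos)]
    rw [mul_comm]
    exact_mod_cast Nat.lt_mul_div_succ N hp.pos
  have h2 : ((N / p : ℕ) : ℝ) ≤ N.factorial.factorization p := by exact_mod_cast h
  linarith

/-- Compare log N! = N log N + O(N) with the sum of v_p(N!) log p, where N/p - 1 ≤ v_p(N!) ≤ N/(p -
1). The -1 costs θ(N) ≤ N log 4 by Chebyshev; replacing 1/(p - 1) by 1/p costs a convergent series.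
-/
theorem exists_abs_sum_log_div_sub_log_le :
    ∃ C : ℝ, 0 < C ∧ ∀ x : ℝ, 1 ≤ x →
      |∑ p ∈ ⌊x⌋₊.primesLE, Real.log p / p - Real.log x| ≤ C := by
  obtain ⟨C, hC, hsum⟩ := exists_sum_log_div_mul_pred_le
  have h4 : 0 ≤ Real.log 4 := Real.log_nonneg (by norm_num)
  refine ⟨C + Real.log 4 + 2, by positivity, fun x hx => ?_⟩
  set N := ⌊x⌋₊ with hN
  have hN1 : 1 ≤ N := Nat.one_le_floor_iff _ |>.2 hx
  have hN0 : (0 : ℝ) < N := by exact_mod_cast hN1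
  have hNx : (N : ℝ) ≤ x := Nat.floor_le (by linarith)
  have hxN : x ≤ 2 * N := by
    have := Nat.lt_floor_add_one x
    have : (1 : ℝ) ≤ N := by exact_mod_cast hN1
    linarith
  have hlogx1 : Real.log N ≤ Real.log x := Real.log_le_log hN0 hNx
  have hlogx2 : Real.log x ≤ Real.log N + 1 := by
    have := Real.log_le_log (by linarith) hxN
    rw [Real.log_mul (by norm_num) hN0.ne'] at this
    linarith [Real.log_two_lt_d9]
  have hupper : Real.log N.factorial ≤ N * Real.log N := by
    rw [← Real.log_pow]
    exact Real.log_le_log (by exact_mod_cast N.factorial_pos) (by exact_mod_cast N.factorial_le_pow)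
  have hlower : N * Real.log N - N ≤ Real.log N.factorial := by
    have := Stirling.le_log_factorial_stirling (n := N) (by omega)
    have h1 : 0 ≤ Real.log N := Real.log_nonneg (by exact_mod_cast hN1)
    have h2 : 0 ≤ Real.log (2 * Real.pi) := Real.log_nonneg (by linarith [Real.pi_gt_three])
    linarith
  have htheta : ∑ p ∈ N.primesLE, Real.log p ≤ Real.log 4 * N := by
    rw [← Chebyshev.theta_eq_sum_primesLE_log]
    exact Chebyshev.theta_le_log4_mul_x hN0.le
  have hge : N * ∑ p ∈ N.primesLE, Real.log p / p - ∑ p ∈ N.primesLE, Real.log p ≤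
      Real.log N.factorial := by
    rw [log_factorial_eq_sum, mul_sum, ← sum_sub_distrib]
    refine sum_le_sum fun p hp => ?_
    have hp := (Nat.mem_primesLE.1 hp).2
    have := mul_le_mul_of_nonneg_right (le_factorization_factorial (N := N) hp)
      (Real.log_nonneg (by exact_mod_cast hp.one_le : (1 : ℝ) ≤ p))
    refine le_trans (le_of_eq ?_) this
    ring
  have hle : Real.log N.factorial ≤ N * ∑ p ∈ N.primesLE, Real.log p / p +
      N * ∑ p ∈ N.primesLE, Real.log p / ((p : ℝ) * (p - 1)) := by
    rw [log_factorial_eq_sum, mul_sum, mul_sum, ← sum_add_distrib]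
    refine sum_le_sum fun p hp => ?_
    have hp := (Nat.mem_primesLE.1 hp).2
    have hp2 : (2 : ℝ) ≤ p := by exact_mod_cast hp.two_le
    have hp1 : (0 : ℝ) < p - 1 := by linarith
    have hp0 : (0 : ℝ) < p := by linarith
    have h := factorization_factorial_le (N := N) hp
    rw [← le_div_iff₀ hp1] at h
    have := mul_le_mul_of_nonneg_right h (Real.log_nonneg (by linarith : (1 : ℝ) ≤ p))
    refine this.trans (le_of_eq ?_)
    field_simp
    ring
  have hS := hsum N.primesLE fun p hp => (Nat.mem_primesLE.1 hp).2.two_le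
  rw [abs_le]
  constructor
  · have : N * (Real.log N - 1 - C) ≤ N * ∑ p ∈ N.primesLE, Real.log p / p := by
      nlinarith [mul_le_mul_of_nonneg_left hS hN0.le]
    have := le_of_mul_le_mul_left this hN0
    linarith
  · have : N * ∑ p ∈ N.primesLE, Real.log p / p ≤ N * (Real.log N + Real.log 4) := by linarith
    have := le_of_mul_le_mul_left this hN0
    linarith

/-- Abel summation of log p/p against 1/log t, using S(t) = log t + O(1). The boundary terms cost
C/log x + C/log y and the integral C/log x - C/log y, which add up to 2C/log x. Being a Cauchy
estimate, it yields the limit without naming it. -/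
theorem exists_abs_sum_one_div_sub_sub_le :
    ∃ C : ℝ, 0 < C ∧ ∀ x y : ℝ, 2 ≤ x → x ≤ y →
      |(∑ p ∈ ⌊y⌋₊.primesLE, 1 / (p : ℝ) - Real.log (Real.log y)) -
        (∑ p ∈ ⌊x⌋₊.primesLE, 1 / (p : ℝ) - Real.log (Real.log x))| ≤ C / Real.log x := by
  obtain ⟨C, hC, hS⟩ := exists_abs_sum_log_div_sub_log_le
  refine ⟨2 * C, by positivity, fun x y hx hxy => ?_⟩
  set c : ℕ → ℝ := fun k => if k.Prime then Real.log k / k else 0 with hc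
  set S : ℝ → ℝ := fun t => ∑ k ∈ Icc 0 ⌊t⌋₊, c k with hSdef
  have hSeq : ∀ t, S t = ∑ p ∈ ⌊t⌋₊.primesLE, Real.log p / p := fun t => by
    rw [Nat.primesLE_eq_filter_Icc_zero, sum_filter]
  have hSR : ∀ t, 1 ≤ t → |S t - Real.log t| ≤ C := fun t ht => by
    rw [hSeq]; exact hS t ht
  have hlog : ∀ t, 2 ≤ t → 0 < Real.log t := fun t ht => Real.log_pos (by linarith)
  have hd : ∀ t, 2 ≤ t → HasDerivAt (fun t => 1 / Real.log t) (-(1 / (t * Real.log t ^ 2))) t := by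
    intro t ht
    have ht0 : t ≠ 0 := by linarith
    have h1 := (hlog t ht).ne'
    have := (Real.hasDerivAt_log ht0).fun_inv h1
    simp only [one_div]
    refine this.congr_deriv ?_
    field_simp
  have hdd : ∀ t, 2 ≤ t →
      HasDerivAt (fun t => -Real.log (Real.log t)) (-(1 / (t * Real.log t ^ 2)) * Real.log t) t := by
    intro t ht
    have ht0 : t ≠ 0 := by linarith
    have h1 := (hlog t ht).ne'
    refine ((Real.hasDerivAt_log ht0).log h1).fun_neg.congr_deriv ?_
    field_simp
  have hcont : ContinuousOn (fun t : ℝ => -(1 / (t * Real.log t ^ 2))) (Set.Icc x y) := by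
    refine ContinuousOn.neg (continuousOn_const.div (continuousOn_id.mul
      ((Real.continuousOn_log.mono fun t ht => ?_).pow 2)) fun t ht => ?_)
    · have := ht.1
      simp only [Set.mem_compl_iff, Set.mem_singleton_iff]; linarith
    · have h1 := hlog t (hx.trans ht.1)
      have : 0 < t := by linarith [ht.1]
      positivity
  have hlogc : ContinuousOn Real.log (Set.Icc x y) :=
    Real.continuousOn_log.mono fun t ht => by
      have := ht.1
      simp only [Set.mem_compl_iff, Set.mem_singleton_iff]; linarith
  have hderiv : ∀ t ∈ Set.Icc x y, deriv (fun t => 1 / Real.log t) t = -(1 / (t * Real.log t ^ 2)) :=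
    fun t ht => (hd t (hx.trans ht.1)).deriv
  have hint : MeasureTheory.IntegrableOn (deriv fun t => 1 / Real.log t) (Set.Icc x y) :=
    (hcont.integrableOn_Icc).congr_fun (fun t ht => (hderiv t ht).symm) measurableSet_Icc
  have habel := sum_mul_eq_sub_sub_integral_mul c (f := fun t => 1 / Real.log t)
    (by linarith : 0 ≤ x) hxy (fun t ht => (hd t (hx.trans ht.1)).differentiableAt) hint
  have hleft : ∑ k ∈ Ioc ⌊x⌋₊ ⌊y⌋₊, 1 / Real.log k * c k =
      ∑ p ∈ ⌊y⌋₊.primesLE, 1 / (p : ℝ) - ∑ p ∈ ⌊x⌋₊.primesLE, 1 / (p : ℝ) := by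
    have hfl : ⌊x⌋₊ ≤ ⌊y⌋₊ := Nat.floor_mono hxy
    have e : ∀ k ∈ Ioc ⌊x⌋₊ ⌊y⌋₊, 1 / Real.log k * c k = if k.Prime then 1 / (k : ℝ) else 0 := by
      intro k hk
      simp only [hc]
      split_ifs with hp
      · have : 0 < Real.log k := Real.log_pos (by exact_mod_cast hp.one_lt)
        field_simp
      · simp
    rw [sum_congr rfl e, Nat.primesLE_eq_filter_Ioc_zero, Nat.primesLE_eq_filter_Ioc_zero,
      sum_filter, sum_filter, eq_sub_iff_add_eq, add_comm]
    exact sum_Ioc_consecutive (fun k : ℕ => if k.Prime then 1 / (k : ℝ) else 0) (Nat.zero_le _) hfl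
  rw [hleft] at habel
  have hint2 : ∫ t in Set.Ioc x y, deriv (fun t => 1 / Real.log t) t * ∑ k ∈ Icc 0 ⌊t⌋₊, c k =
      ∫ t in x..y, -(1 / (t * Real.log t ^ 2)) * S t := by
    rw [intervalIntegral.integral_of_le hxy]
    exact MeasureTheory.setIntegral_congr_fun measurableSet_Ioc fun t ht => by
      simp only [hderiv t (Set.Ioc_subset_Icc_self ht), hSdef]
  rw [hint2] at habel
  have hmono : Monotone S := fun s t hst =>
    sum_le_sum_of_subset_of_nonneg (Icc_subset_Icc_right (Nat.floor_mono hst)) fun k _ _ => by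
      simp only [hc]
      split_ifs
      · positivity
      · exact le_rfl
  have hu : Set.uIcc x y = Set.Icc x y := Set.uIcc_of_le hxy
  have hI1 : IntervalIntegrable (fun t => -(1 / (t * Real.log t ^ 2)) * S t)
      MeasureTheory.volume x y :=
    hmono.intervalIntegrable.continuousOn_mul (hu ▸ hcont)
  have hI2 : IntervalIntegrable (fun t => -(1 / (t * Real.log t ^ 2)) * Real.log t)
      MeasureTheory.volume x y :=
    (hu ▸ hcont.mul hlogc : ContinuousOn _ (Set.uIcc x y)).intervalIntegrable
  have hI3 : IntervalIntegrable (fun t : ℝ => -(1 / (t * Real.log t ^ 2)))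
      MeasureTheory.volume x y := (hu ▸ hcont : ContinuousOn _ (Set.uIcc x y)).intervalIntegrable
  have hF2 : ∫ t in x..y, -(1 / (t * Real.log t ^ 2)) * Real.log t =
      -Real.log (Real.log y) - -Real.log (Real.log x) :=
    intervalIntegral.integral_eq_sub_of_hasDerivAt
      (fun t ht => hdd t (hx.trans (hu ▸ ht : t ∈ Set.Icc x y).1)) hI2
  have hF3 : ∫ t in x..y, -(1 / (t * Real.log t ^ 2)) = 1 / Real.log y - 1 / Real.log x :=
    intervalIntegral.integral_eq_sub_of_hasDerivAt
      (fun t ht => hd t (hx.trans (hu ▸ ht : t ∈ Set.Icc x y).1)) hI3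
  have hR : |(∫ t in x..y, -(1 / (t * Real.log t ^ 2)) * S t) -
      ∫ t in x..y, -(1 / (t * Real.log t ^ 2)) * Real.log t| ≤
      C * (1 / Real.log x - 1 / Real.log y) := by
    rw [← intervalIntegral.integral_sub hI1 hI2]
    have := intervalIntegral.norm_integral_le_of_norm_le (f := fun t =>
      -(1 / (t * Real.log t ^ 2)) * S t - -(1 / (t * Real.log t ^ 2)) * Real.log t)
      (g := fun t : ℝ => -C * -(1 / (t * Real.log t ^ 2))) hxy
      (Filter.Eventually.of_forall fun t ht => by
        have h1 := hlog t (hx.trans ht.1.le)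
        have h2 : 0 < t := by linarith [ht.1]
        rw [← mul_sub, norm_mul, norm_neg, Real.norm_eq_abs, Real.norm_eq_abs,
          abs_of_pos (by positivity : 0 < 1 / (t * Real.log t ^ 2)), neg_mul_neg, mul_comm]
        exact mul_le_mul_of_nonneg_right (hSR t (by linarith [ht.1])) (by positivity))
      (hI3.const_mul _)
    rw [intervalIntegral.integral_const_mul, hF3, Real.norm_eq_abs] at this
    linarith
  have hlx := hlog x hx
  have hly := hlog y (hx.trans hxy)
  have hRx : |1 / Real.log x * S x - 1| ≤ C / Real.log x := by
    have : 1 / Real.log x * S x - 1 = (S x - Real.log x) / Real.log x := by field_simp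
    rw [this, abs_div, abs_of_pos hlx]
    exact div_le_div_of_nonneg_right (hSR x (by linarith)) hlx.le
  have hRy : |1 / Real.log y * S y - 1| ≤ C / Real.log y := by
    have : 1 / Real.log y * S y - 1 = (S y - Real.log y) / Real.log y := by field_simp
    rw [this, abs_div, abs_of_pos hly]
    exact div_le_div_of_nonneg_right (hSR y (by linarith)) hly.le
  have e1 : ∑ k ∈ Icc 0 ⌊x⌋₊, c k = S x := rfl
  have e2 : ∑ k ∈ Icc 0 ⌊y⌋₊, c k = S y := rfl
  simp only [e1, e2] at habel
  rw [hF2] at hR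
  rw [abs_le] at hR hRx hRy ⊢
  have e3 : 2 * C / Real.log x = C / Real.log x + C / Real.log x := by ring
  have e4 : C * (1 / Real.log x - 1 / Real.log y) = C / Real.log x - C / Real.log y := by ring
  rw [e3]
  rw [e4] at hR
  constructor <;> linarith [hR.1, hR.2, hRx.1, hRx.2, hRy.1, hRy.2]

theorem exists_sum_one_div_prime_sub_loglog :
    ∃ M C : ℝ, 0 < C ∧ ∀ x : ℝ, 2 ≤ x →
      |∑ p ∈ ⌊x⌋₊.primesLE, 1 / (p : ℝ) - Real.log (Real.log x) - M| ≤ C / Real.log x := by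
  obtain ⟨C, hC, h⟩ := exists_abs_sum_one_div_sub_sub_le
  set D : ℝ → ℝ := fun x => ∑ p ∈ ⌊x⌋₊.primesLE, 1 / (p : ℝ) - Real.log (Real.log x) with hD
  have hcauchy : Cauchy (Filter.map D Filter.atTop) := by
    rw [Metric.cauchy_iff]
    refine ⟨inferInstance, fun ε hε => ?_⟩
    have ht : Filter.Tendsto (fun x => C / Real.log x) Filter.atTop (nhds 0) :=
      Real.tendsto_log_atTop.const_div_atTop C
    obtain ⟨X, hX2, hX⟩ := ((Filter.eventually_ge_atTop 2).and
      (ht.eventually (gt_mem_nhds (half_pos hε)))).exists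
    refine ⟨D '' Set.Ici X, Filter.image_mem_map (Filter.Ici_mem_atTop X), ?_⟩
    rintro _ ⟨a, ha, rfl⟩ _ ⟨b, hb, rfl⟩
    have h1 := h X a hX2 ha
    have h2 := h X b hX2 hb
    rw [Real.dist_eq]
    rw [abs_le] at h1 h2
    rw [abs_lt]
    constructor <;> simp only [hD] <;> linarith [h1.1, h1.2, h2.1, h2.2]
  obtain ⟨M, hM⟩ := cauchy_map_iff_exists_tendsto.1 hcauchy
  refine ⟨M, C, hC, fun x hx => ?_⟩
  have hlim : Filter.Tendsto (fun y => |D y - D x|) Filter.atTop (nhds |M - D x|) :=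
    (hM.sub_const _).abs
  have := le_of_tendsto hlim ((Filter.eventually_ge_atTop x).mono fun y hy => h x y hx hy)
  rwa [abs_sub_comm] at this

/-! ### Identification of the Meissel–Mertens constant -/

theorem abs_log_one_sub_add_le {x : ℝ} (h0 : 0 ≤ x) (h : x ≤ 1 / 2) :
    |Real.log (1 - x) + x| ≤ 2 * x ^ 2 := by
  have habs : |x| = x := abs_of_nonneg h0
  have h1 := Real.abs_log_sub_add_sum_range_le (x := x) (by rw [habs]; linarith) 1
  rw [habs] at h1
  simp only [Finset.sum_range_one, Nat.cast_zero, zero_add, pow_one, div_one] at h1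
  rw [add_comm]
  refine h1.trans ?_
  rw [div_le_iff₀ (by linarith)]
  norm_num
  nlinarith [sq_nonneg x]

theorem Nat.Primes.rpow_neg_le_half (p : Nat.Primes) {s : ℝ} (hs : 1 ≤ s) :
    (p : ℝ) ^ (-s) ≤ 1 / 2 := by
  have hp : (2 : ℝ) ≤ (p : ℝ) := by exact_mod_cast p.2.two_le
  calc (p : ℝ) ^ (-s) ≤ (p : ℝ) ^ (-1 : ℝ) := Real.rpow_le_rpow_of_exponent_le (by linarith) (by linarith)
    _ = 1 / p := by rw [Real.rpow_neg_one, one_div]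
    _ ≤ 1 / 2 := one_div_le_one_div_of_le (by norm_num) hp

theorem Nat.Primes.abs_log_one_sub_rpow_add_le (p : Nat.Primes) {s : ℝ} (hs : 1 ≤ s) :
    |Real.log (1 - (p : ℝ) ^ (-s)) + (p : ℝ) ^ (-s)| ≤ 2 * (p : ℝ) ^ (-2 : ℝ) := by
  have hp : (2 : ℝ) ≤ (p : ℝ) := by exact_mod_cast p.2.two_le
  refine (abs_log_one_sub_add_le (by positivity) (p.rpow_neg_le_half hs)).trans ?_
  rw [← Real.rpow_natCast, ← Real.rpow_mul (by positivity)]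
  gcongr
  · linarith
  · push_cast; linarith

theorem Nat.Primes.summable_log_one_sub_rpow_add {s : ℝ} (hs : 1 ≤ s) :
    Summable fun p : Nat.Primes => Real.log (1 - (p : ℝ) ^ (-s)) + (p : ℝ) ^ (-s) :=
  Summable.of_norm_bounded ((Nat.Primes.summable_rpow.2 (by norm_num)).mul_left 2)
    fun p => p.abs_log_one_sub_rpow_add_le hs

theorem tendsto_tsum_log_one_sub_rpow_add :
    Filter.Tendsto (fun δ : ℝ => ∑' p : Nat.Primes,
      (Real.log (1 - (p : ℝ) ^ (-(1 + δ))) + (p : ℝ) ^ (-(1 + δ)))) (nhdsWithin 0 (Set.Ioi 0))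
      (nhds (∑' p : Nat.Primes, (Real.log (1 - 1 / (p : ℝ)) + 1 / (p : ℝ)))) := by
  refine tendsto_tsum_of_dominated_convergence
    ((Nat.Primes.summable_rpow.2 (by norm_num : (-2 : ℝ) < -1)).mul_left 2) (fun p => ?_) ?_
  · have hp : (2 : ℝ) ≤ (p : ℝ) := by exact_mod_cast p.2.two_le
    have h1 : Filter.Tendsto (fun δ : ℝ => (p : ℝ) ^ (-(1 + δ))) (nhdsWithin 0 (Set.Ioi 0))
        (nhds (1 / p)) := by
      have hc : Continuous fun δ : ℝ => (p : ℝ) ^ (-(1 + δ)) :=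
        Continuous.rpow continuous_const (by fun_prop) fun _ => Or.inl (by linarith)
      have := (hc.tendsto 0).mono_left (nhdsWithin_le_nhds (s := Set.Ioi 0))
      simpa [Real.rpow_neg_one] using this
    refine Filter.Tendsto.add (Filter.Tendsto.log (h1.const_sub 1) ?_) h1
    have := one_div_le_one_div_of_le (by norm_num) hp
    linarith
  · filter_upwards [self_mem_nhdsWithin] with δ hδ p
    exact p.abs_log_one_sub_rpow_add_le (by linarith [Set.mem_Ioi.1 hδ])

theorem exp_tsum_neg_log_one_sub_rpow {s : ℝ} (hs : 1 < s) :
    Real.exp (∑' p : Nat.Primes, -Real.log (1 - (p : ℝ) ^ (-s))) = ∑' n : ℕ, 1 / (n : ℝ) ^ s := by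
  have h := riemannZeta_eulerProduct_exp_log (s := (s : ℂ)) (by simpa using hs)
  rw [zeta_eq_tsum_one_div_nat_cpow (by simpa using hs)] at h
  apply Complex.ofReal_injective
  push_cast
  refine Eq.trans (congrArg Complex.exp (tsum_congr fun p => ?_)) (h.trans (tsum_congr fun n => ?_))
  · have := p.rpow_neg_le_half hs.le
    rw [Complex.ofReal_log (by linarith)]
    push_cast
    rw [Complex.ofReal_cpow (by positivity)]
    simp
  · rw [Complex.ofReal_cpow (by positivity)]
    simp

theorem tsum_prime_rpow_eq {s : ℝ} (hs : 1 < s) :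
    ∑' p : Nat.Primes, (p : ℝ) ^ (-s) =
      ∑' p : Nat.Primes, (Real.log (1 - (p : ℝ) ^ (-s)) + (p : ℝ) ^ (-s)) +
        Real.log (∑' n : ℕ, 1 / (n : ℝ) ^ s) := by
  have h1 : Summable fun p : Nat.Primes => (p : ℝ) ^ (-s) :=
    Nat.Primes.summable_rpow.2 (by linarith)
  have h2 := Nat.Primes.summable_log_one_sub_rpow_add hs.le
  rw [← exp_tsum_neg_log_one_sub_rpow hs, Real.log_exp]
  have h3 : Summable fun p : Nat.Primes => -Real.log (1 - (p : ℝ) ^ (-s)) :=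
    (h1.sub h2).congr fun p => by ring
  rw [← h2.tsum_add h3]
  exact tsum_congr fun p => by ring

theorem tsum_exp_neg_div {δ : ℝ} (hδ : 0 < δ) :
    HasSum (fun n : ℕ => 1 / ((n : ℝ) + 1) * Real.exp (-(δ * (n + 1)))) 
      (-Real.log (1 - Real.exp (-δ))) := by
  have h := Real.hasSum_pow_div_log_of_abs_lt_one (x := Real.exp (-δ))
    (by rw [abs_of_pos (Real.exp_pos _)]; simpa using hδ)
  refine h.congr_fun fun n => ?_
  rw [← Real.exp_nat_mul]
  push_cast
  rw [show ((n : ℝ) + 1) * -δ = -(δ * (n + 1)) by ring]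
  ring

/-- By the Euler product, the prime zeta value is log ζ(1+δ) plus a series dominated by 2p^(-2). The
simple pole gives δζ(1+δ) → 1, while (1 - e^(-δ))/δ → 1, so the two logarithms cancel in the limit.
-/
theorem tendsto_tsum_prime_rpow_add_log :
    Filter.Tendsto (fun δ : ℝ => ∑' p : Nat.Primes, (p : ℝ) ^ (-(1 + δ)) +
      Real.log (1 - Real.exp (-δ))) (nhdsWithin 0 (Set.Ioi 0))
      (nhds (∑' p : Nat.Primes, (Real.log (1 - 1 / (p : ℝ)) + 1 / (p : ℝ)))) := by
  have hz : Filter.Tendsto (fun δ : ℝ => δ * ∑' n : ℕ, 1 / (n : ℝ) ^ (1 + δ))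
      (nhdsWithin 0 (Set.Ioi 0)) (nhds 1) := by
    have ht : Filter.Tendsto (fun δ : ℝ => 1 + δ) (nhdsWithin 0 (Set.Ioi 0))
        (nhdsWithin 1 (Set.Ioi 1)) := by
      refine tendsto_nhdsWithin_iff.2 ⟨?_, ?_⟩
      · have : Continuous fun δ : ℝ => 1 + δ := by fun_prop
        simpa using (this.tendsto 0).mono_left (nhdsWithin_le_nhds (s := Set.Ioi 0))
      · filter_upwards [self_mem_nhdsWithin] with δ hδ
        simpa using hδ
    refine (tendsto_sub_mul_tsum_nat_rpow.comp ht).congr fun δ => ?_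
    simp
  have he : Filter.Tendsto (fun δ : ℝ => (1 - Real.exp (-δ)) / δ) (nhdsWithin 0 (Set.Ioi 0))
      (nhds 1) := by
    have hd : HasDerivAt (fun δ : ℝ => 1 - Real.exp (-δ)) 1 0 := by
      have := ((hasDerivAt_neg (0 : ℝ)).exp).const_sub 1
      simpa using this
    have := hd.tendsto_slope.mono_left (nhdsWithin_mono 0 fun x (hx : 0 < x) => hx.ne')
    refine this.congr fun δ => ?_
    simp [slope_def_field]
  have := tendsto_tsum_log_one_sub_rpow_add.add ((hz.mul he).log (by norm_num))
  simp only [mul_one, Real.log_one, add_zero] at this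
  refine this.congr' ?_
  filter_upwards [self_mem_nhdsWithin] with δ hδ
  have hδ : 0 < δ := hδ
  rw [tsum_prime_rpow_eq (by linarith), add_assoc, ← Real.log_mul]
  · congr 2
    field_simp
  · rw [← exp_tsum_neg_log_one_sub_rpow (by linarith)]
    positivity
  · have : Real.exp (-δ) < 1 := by simpa using hδ
    linarith

/-- Termwise integration: the jump at l i contributes a i times the integral of e^(-u) over u ≥ δ l
i. It is applied with jumps at log p and at the positive integers, so that both step functions are
averaged by the same kernel. -/
theorem integral_exp_neg_mul_tsum_indicator {ι : Type*} [Countable ι] {a l : ι → ℝ}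
    (ha : ∀ i, 0 ≤ a i) (hl : ∀ i, 0 ≤ l i) {δ : ℝ} (hδ : 0 < δ)
    (hs : Summable fun i => a i * Real.exp (-(δ * l i))) :
    ∫ u in Set.Ioi (0 : ℝ), Real.exp (-u) * ∑' i, (if l i ≤ u / δ then a i else 0) =
      ∑' i, a i * Real.exp (-(δ * l i)) := by
  set F : ι → ℝ → ℝ := fun i => (Set.Ici (δ * l i)).indicator fun u => a i * Real.exp (-u) with hF
  have hmem : ∀ i u, u ∈ Set.Ici (δ * l i) ↔ l i ≤ u / δ := fun i u => by
    rw [Set.mem_Ici, le_div_iff₀ hδ, mul_comm]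
  have hsub : ∀ i, Set.Ici (δ * l i) ∩ Set.Ici 0 = Set.Ici (δ * l i) := fun i =>
    Set.inter_eq_left.2 (Set.Ici_subset_Ici.2 (mul_nonneg hδ.le (hl i)))
  have hint : ∀ i, MeasureTheory.Integrable (F i) (MeasureTheory.volume.restrict (Set.Ici 0)) := by
    intro i
    rw [hF, MeasureTheory.integrable_indicator_iff measurableSet_Ici,
      MeasureTheory.IntegrableOn, MeasureTheory.Measure.restrict_restrict measurableSet_Ici, hsub]
    have h0 : MeasureTheory.IntegrableOn (fun u => Real.exp (-u)) (Set.Ici (δ * l i)) := by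
      rw [integrableOn_Ici_iff_integrableOn_Ioi]
      simpa using integrableOn_exp_mul_Ioi (a := -1) (by norm_num) (δ * l i)
    exact MeasureTheory.Integrable.const_mul h0 (a i)
  have hval : ∀ i, ∫ u in Set.Ici (0 : ℝ), F i u = a i * Real.exp (-(δ * l i)) := by
    intro i
    rw [hF, MeasureTheory.integral_indicator measurableSet_Ici,
      MeasureTheory.Measure.restrict_restrict measurableSet_Ici, hsub,
      MeasureTheory.integral_Ici_eq_integral_Ioi, MeasureTheory.integral_const_mul,
      integral_exp_neg_Ioi]
  have hnorm : ∀ i u, ‖F i u‖ = F i u := fun i u => by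
    rw [Real.norm_eq_abs, abs_of_nonneg]
    exact Set.indicator_nonneg (fun u _ => mul_nonneg (ha i) (Real.exp_pos _).le) u
  have h := MeasureTheory.hasSum_integral_of_summable_integral_norm hint
    (by simpa only [hnorm, hval] using hs)
  simp only [hval] at h
  rw [h.tsum_eq, MeasureTheory.integral_Ici_eq_integral_Ioi]
  congr 1
  ext u
  rw [← tsum_mul_left]
  refine tsum_congr fun i => ?_
  simp only [hF, Set.indicator_apply, hmem]
  split_ifs <;> ring

theorem tsum_ite_log_prime_le (v : ℝ) :
    ∑' p : Nat.Primes, (if Real.log p ≤ v then 1 / (p : ℝ) else 0) =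
      ∑ p ∈ ⌊Real.exp v⌋₊.primesLE, 1 / (p : ℝ) := by
  have h1 : ∑' p : Nat.Primes, (if Real.log p ≤ v then 1 / (p : ℝ) else 0) =
      ∑' n : ℕ, {p : ℕ | p.Prime}.indicator
        (fun n : ℕ => if Real.log n ≤ v then 1 / (n : ℝ) else 0) n :=
    tsum_subtype {p : ℕ | p.Prime} fun n : ℕ => if Real.log n ≤ v then 1 / (n : ℝ) else 0
  have hmem : ∀ n : ℕ, n.Prime → (Real.log n ≤ v ↔ n ≤ ⌊Real.exp v⌋₊) := fun n hn => by
    rw [Nat.le_floor_iff (Real.exp_pos v).le, Real.log_le_iff_le_exp (by exact_mod_cast hn.pos)]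
  rw [h1, tsum_eq_sum (s := ⌊Real.exp v⌋₊.primesLE)]
  · refine sum_congr rfl fun n hn => ?_
    obtain ⟨h2, h3⟩ := Nat.mem_primesLE.1 hn
    rw [Set.indicator_of_mem (show n ∈ {p : ℕ | p.Prime} from h3), if_pos ((hmem n h3).2 h2)]
  · intro n hn
    by_cases h3 : n.Prime
    · rw [Set.indicator_of_mem (show n ∈ {p : ℕ | p.Prime} from h3), if_neg]
      exact fun h => hn (Nat.mem_primesLE.2 ⟨(hmem n h3).1 h, h3⟩)
    · exact Set.indicator_of_notMem (by simpa using h3) _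

theorem tsum_ite_succ_le (v : ℝ) :
    ∑' n : ℕ, (if (n : ℝ) + 1 ≤ v then 1 / ((n : ℝ) + 1) else 0) = harmonic ⌊v⌋₊ := by
  have hmem : ∀ n : ℕ, (n : ℝ) + 1 ≤ v ↔ n ∈ range ⌊v⌋₊ := fun n => by
    rw [mem_range, ← Nat.succ_le_iff, Nat.le_floor_iff' (Nat.succ_ne_zero n)]
    push_cast
    rfl
  rw [tsum_eq_sum (s := range ⌊v⌋₊)]
  · rw [harmonic]
    push_cast
    refine sum_congr rfl fun n hn => ?_
    rw [if_pos ((hmem n).2 hn), one_div]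
  · intro n hn
    exact if_neg fun h => hn ((hmem n).1 h)

theorem integral_exp_neg_mul_sum_primes {δ : ℝ} (hδ : 0 < δ) :
    ∫ u in Set.Ioi (0 : ℝ), Real.exp (-u) * ∑ p ∈ ⌊Real.exp (u / δ)⌋₊.primesLE, 1 / (p : ℝ) =
      ∑' p : Nat.Primes, (p : ℝ) ^ (-(1 + δ)) := by
  have e : ∀ p : Nat.Primes, 1 / (p : ℝ) * Real.exp (-(δ * Real.log p)) = (p : ℝ) ^ (-(1 + δ)) := by
    intro p
    have hp : (0 : ℝ) < p := by exact_mod_cast p.2.pos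
    rw [neg_add, Real.rpow_add hp, Real.rpow_neg_one, one_div, Real.rpow_def_of_pos hp]
    ring_nf
  have h := integral_exp_neg_mul_tsum_indicator (ι := Nat.Primes) (a := fun p => 1 / (p : ℝ))
    (l := fun p => Real.log p) (fun p => by positivity)
    (fun p => Real.log_nonneg (by exact_mod_cast p.2.one_le)) hδ
    ((Nat.Primes.summable_rpow.2 (by linarith : -(1 + δ) < -1)).congr fun p => (e p).symm)
  simpa only [tsum_ite_log_prime_le, e] using h

theorem integral_exp_neg_mul_harmonic {δ : ℝ} (hδ : 0 < δ) :
    ∫ u in Set.Ioi (0 : ℝ), Real.exp (-u) * (harmonic ⌊u / δ⌋₊ : ℝ) =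
      -Real.log (1 - Real.exp (-δ)) := by
  have h := integral_exp_neg_mul_tsum_indicator (ι := ℕ) (a := fun n => 1 / ((n : ℝ) + 1))
    (l := fun n => (n : ℝ) + 1) (fun n => by positivity) (fun n => by positivity) hδ
    (tsum_exp_neg_div hδ).summable
  simpa only [tsum_ite_succ_le, (tsum_exp_neg_div hδ).tsum_eq] using h

theorem tendsto_integral_exp_neg_mul_comp_div {D : ℝ → ℝ} {K l : ℝ} (hmeas : Measurable D)
    (hK : ∀ v, 0 < v → |D v| ≤ K) (hl : Filter.Tendsto D Filter.atTop (nhds l)) :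
    Filter.Tendsto (fun δ : ℝ => ∫ u in Set.Ioi (0 : ℝ), Real.exp (-u) * D (u / δ))
      (nhdsWithin 0 (Set.Ioi 0)) (nhds l) := by
  have h1 : ∫ u in Set.Ioi (0 : ℝ), Real.exp (-u) * l = l := by
    rw [MeasureTheory.integral_mul_const, integral_exp_neg_Ioi_zero, one_mul]
  rw [← h1]
  refine MeasureTheory.tendsto_integral_filter_of_dominated_convergence
    (fun u => Real.exp (-u) * K) ?_ ?_ ?_ ?_
  · refine Filter.Eventually.of_forall fun δ => Measurable.aestronglyMeasurable ?_
    exact (by fun_prop : Measurable fun u : ℝ => Real.exp (-u)).mul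
      (hmeas.comp (by fun_prop))
  · filter_upwards [self_mem_nhdsWithin] with δ hδ
    filter_upwards [MeasureTheory.ae_restrict_mem measurableSet_Ioi] with u hu
    rw [norm_mul, Real.norm_eq_abs, abs_of_pos (Real.exp_pos _)]
    exact mul_le_mul_of_nonneg_left (hK _ (div_pos hu hδ)) (Real.exp_pos _).le
  · have : MeasureTheory.IntegrableOn (fun u => Real.exp (-u)) (Set.Ioi 0) := by
      simpa using integrableOn_exp_mul_Ioi (a := -1) (by norm_num) 0
    exact MeasureTheory.Integrable.mul_const this K
  · filter_upwards [MeasureTheory.ae_restrict_mem measurableSet_Ioi] with u hu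
    refine (hl.comp ?_).const_mul _
    have := (tendsto_inv_nhdsGT_zero (𝕜 := ℝ)).const_mul_atTop (show (0 : ℝ) < u from hu)
    exact this.congr fun δ => by rw [div_eq_mul_inv]

/-- An Abelian argument. Let B(v) sum 1/p over p ≤ e^v and let H(v) be the harmonic sum up to v.
Then B - H → M - γ, hence so do its exponential averages at scale 1/δ. These averages equal the
prime zeta value at 1+δ plus log(1 - e^(-δ)), whose limit is the series over primes. -/
theorem exists_abs_sum_one_div_prime_sub_loglog_sub_le :
    ∃ C : ℝ, 0 < C ∧ ∀ x : ℝ, 2 ≤ x →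
      |∑ p ∈ ⌊x⌋₊.primesLE, 1 / (p : ℝ) - Real.log (Real.log x) - meisselMertens| ≤
        C / Real.log x := by
  obtain ⟨M, C, hC, hM⟩ := exists_sum_one_div_prime_sub_loglog
  suffices h : M = meisselMertens from ⟨C, hC, h ▸ hM⟩
  set B : ℝ → ℝ := fun v => ∑ p ∈ ⌊Real.exp v⌋₊.primesLE, 1 / (p : ℝ) with hB
  set H : ℝ → ℝ := fun v => (harmonic ⌊v⌋₊ : ℝ) with hH
  have hexp : ∀ v : ℝ, 1 ≤ v → 2 ≤ Real.exp v := fun v hv => by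
    have := Real.add_one_le_exp v; linarith
  have hBM : ∀ v : ℝ, 1 ≤ v → |B v - Real.log v - M| ≤ C / v := fun v hv => by
    have := hM (Real.exp v) (hexp v hv)
    rwa [Real.log_exp] at this
  have hBmono : Monotone B := fun s t hst =>
    sum_le_sum_of_subset_of_nonneg (Nat.primesLE_mono (Nat.floor_mono (Real.exp_le_exp.2 hst)))
      fun p _ _ => by positivity
  have hHmono : Monotone H := fun s t hst => by
    simp only [hH, harmonic]
    push_cast
    exact sum_le_sum_of_subset_of_nonneg (range_mono (Nat.floor_mono hst)) fun p _ _ => by positivity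
  have hB0 : ∀ v, 0 ≤ B v := fun v => sum_nonneg fun p _ => by positivity
  have hH0 : ∀ v, 0 ≤ H v := fun v => by
    simp only [hH, harmonic]
    push_cast
    exact sum_nonneg fun p _ => by positivity
  have hBlim : Filter.Tendsto (fun v => B v - Real.log v) Filter.atTop (nhds M) := by
    rw [← tendsto_sub_nhds_zero_iff]
    refine squeeze_zero_norm' ?_ (Filter.tendsto_id.const_div_atTop C)
    filter_upwards [Filter.eventually_ge_atTop 1] with v hv
    exact hBM v hv
  have hHlim : Filter.Tendsto (fun v => H v - Real.log v) Filter.atTop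
      (nhds Real.eulerMascheroniConstant) := by
    have h1 := Real.tendsto_harmonic_sub_log.comp (tendsto_nat_floor_atTop (α := ℝ))
    have h2 := (tendsto_nat_floor_div_atTop (R := ℝ)).log one_ne_zero
    have h3 := h1.add h2
    rw [Real.log_one, add_zero] at h3
    refine h3.congr' ?_
    filter_upwards [Filter.eventually_ge_atTop 1] with v hv
    have hv1 : (⌊v⌋₊ : ℝ) ≠ 0 := by
      have := Nat.one_le_floor_iff v |>.2 hv
      positivity
    simp only [Function.comp_apply, hH]
    rw [Real.log_div hv1 (by linarith)]
    ring
  have hbound : ∀ v, 0 < v → |B v - H v| ≤ C + |M| + 2 + B 1 + H 1 := by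
    intro v hv
    -- Near 0 the comparison with log v is useless; there monotonicity bounds both step functions by
    -- their values at 1.
    rcases le_total v 1 with h | h
    · have h1 := hBmono h
      have h2 := hHmono h
      rw [abs_le]
      constructor <;> linarith [hB0 v, hH0 v, hB0 1, hH0 1, abs_nonneg M]
    · have h1 := hBM v h
      have h2 : C / v ≤ C := div_le_self hC.le h
      have h3 : Real.log v ≤ H v := log_le_harmonic_floor v hv.le
      have h4 : H v ≤ 1 + Real.log v := harmonic_floor_le_one_add_log v h
      have h5 := abs_le.1 (h1.trans h2)
      rw [abs_le]
      constructor <;> linarith [hB0 1, hH0 1, neg_abs_le M, le_abs_self M, h5.1, h5.2]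
  have hlim : Filter.Tendsto (fun v => B v - H v) Filter.atTop
      (nhds (M - Real.eulerMascheroniConstant)) :=
    (hBlim.sub hHlim).congr fun v => by ring
  have hA := tendsto_integral_exp_neg_mul_comp_div
    (hBmono.measurable.sub hHmono.measurable) hbound hlim
  have hprime : ∀ δ : ℝ, 0 < δ → 0 < ∑' p : Nat.Primes, (p : ℝ) ^ (-(1 + δ)) := fun δ hδ =>
    (Nat.Primes.summable_rpow.2 (by linarith)).tsum_pos (fun p => by positivity) ⟨2, Nat.prime_two⟩
      (by positivity)
  have hlog : ∀ δ : ℝ, 0 < δ → 0 < -Real.log (1 - Real.exp (-δ)) := fun δ hδ => by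
    have h1 : Real.exp (-δ) < 1 := by simpa using hδ
    have := Real.log_neg (by linarith) (by linarith [Real.exp_pos (-δ)] : 1 - Real.exp (-δ) < 1)
    linarith
  have hT := tendsto_tsum_prime_rpow_add_log
  have heq : (fun δ : ℝ => ∫ u in Set.Ioi (0 : ℝ), Real.exp (-u) * (B (u / δ) - H (u / δ)))
      =ᶠ[nhdsWithin 0 (Set.Ioi 0)] fun δ : ℝ => ∑' p : Nat.Primes, (p : ℝ) ^ (-(1 + δ)) +
      Real.log (1 - Real.exp (-δ)) := by
    filter_upwards [self_mem_nhdsWithin] with δ hδ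
    have h1 := integral_exp_neg_mul_sum_primes hδ
    have h2 := integral_exp_neg_mul_harmonic hδ
    simp only [mul_sub]
    -- A non-integrable function has integral 0 by convention, so the nonzero values of both
    -- integrals prove integrability.
    rw [MeasureTheory.integral_sub
      (MeasureTheory.Integrable.of_integral_ne_zero (h1 ▸ (hprime δ hδ).ne'))
      (MeasureTheory.Integrable.of_integral_ne_zero (h2 ▸ (hlog δ hδ).ne')), h1, h2, sub_neg_eq_add]
  have := tendsto_nhds_unique (hA.congr' heq) hT
  rw [meisselMertens, ← this]
  ring

/-! ### Squarefree integers and the expansion of (1+w)^ω -/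

/-- The squarefree positive integers up to `N`. -/
def squarefreeUpTo (N : ℕ) : Finset ℕ := (Icc 1 N).filter Squarefree

theorem mem_squarefreeUpTo {N d : ℕ} : d ∈ squarefreeUpTo N ↔ d ≤ N ∧ Squarefree d := by
  simp only [squarefreeUpTo, mem_filter, mem_Icc]
  exact ⟨fun h => ⟨h.1.2, h.2⟩, fun h => ⟨⟨Nat.pos_of_ne_zero h.2.ne_zero, h.1⟩, h.2⟩⟩

theorem pos_of_mem_squarefreeUpTo {N d : ℕ} (h : d ∈ squarefreeUpTo N) : 0 < d :=
  Nat.pos_of_ne_zero (mem_squarefreeUpTo.1 h).2.ne_zero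

theorem cardDistinctFactors_eq_card_primeFactors (n : ℕ) :
    ArithmeticFunction.cardDistinctFactors n = n.primeFactors.card := by
  rw [ArithmeticFunction.cardDistinctFactors_apply, Nat.primeFactors, List.card_toFinset]

theorem squarefree_mul_prime_iff {m p : ℕ} (hp : p.Prime) :
    Squarefree (m * p) ↔ Squarefree m ∧ ¬ p ∣ m := by
  rw [Nat.squarefree_mul_iff, Nat.coprime_comm, hp.coprime_iff_not_dvd]
  exact ⟨fun h => ⟨h.2.1, h.1⟩, fun h => ⟨h.2, h.1, hp.prime.squarefree⟩⟩

theorem cardDistinctFactors_mul_prime {m p : ℕ} (hp : p.Prime) (h : ¬ p ∣ m) :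
    ArithmeticFunction.cardDistinctFactors (m * p) =
      ArithmeticFunction.cardDistinctFactors m + 1 := by
  rw [ArithmeticFunction.cardDistinctFactors_mul
      (Nat.coprime_comm.1 ((hp.coprime_iff_not_dvd).2 h)),
    ArithmeticFunction.cardDistinctFactors_apply_prime hp]

/-- The bijection (d, p) ↦ (d/p, p). Together with log d = ∑ log p over p ∣ d, it turns a
logarithmic weight on d into a prime sum up to N/m. -/
theorem sum_squarefreeUpTo_sum_primeFactors {M : Type*} [AddCommMonoid M] (N : ℕ)
    (F : ℕ → ℕ → M) :
    ∑ d ∈ squarefreeUpTo N, ∑ p ∈ d.primeFactors, F p (d / p) =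
      ∑ m ∈ squarefreeUpTo N, ∑ p ∈ (N / m).primesLE with ¬ p ∣ m, F p m := by
  rw [sum_sigma', sum_sigma']
  refine sum_bij' (fun a _ => ⟨a.1 / a.2, a.2⟩) (fun a _ => ⟨a.1 * a.2, a.2⟩) ?_ ?_ ?_ ?_ ?_
  · rintro ⟨d, p⟩ h
    simp only [mem_sigma, mem_filter, Nat.mem_primesLE, mem_squarefreeUpTo] at h ⊢
    obtain ⟨⟨hd, hsq⟩, hp⟩ := h
    have hpp := Nat.prime_of_mem_primeFactors hp
    obtain ⟨m, rfl⟩ := Nat.dvd_of_mem_primeFactors hp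
    rw [mul_comm, squarefree_mul_prime_iff hpp] at hsq
    rw [Nat.mul_div_cancel_left _ hpp.pos]
    refine ⟨⟨le_trans (Nat.le_mul_of_pos_left m hpp.pos) hd, hsq.1⟩, ⟨?_, hpp⟩, hsq.2⟩
    rwa [Nat.le_div_iff_mul_le (Nat.pos_of_ne_zero hsq.1.ne_zero)]
  · rintro ⟨m, p⟩ h
    simp only [mem_sigma, mem_filter, Nat.mem_primesLE, mem_squarefreeUpTo] at h ⊢
    obtain ⟨⟨hm, hsq⟩, ⟨hpm, hp⟩, hdvd⟩ := h
    have hm0 := Nat.pos_of_ne_zero hsq.ne_zero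
    rw [Nat.le_div_iff_mul_le hm0, mul_comm] at hpm
    exact ⟨⟨hpm, (squarefree_mul_prime_iff hp).2 ⟨hsq, hdvd⟩⟩,
      Nat.mem_primeFactors.2 ⟨hp, dvd_mul_left _ _, (Nat.mul_pos hm0 hp.pos).ne'⟩⟩
  · rintro ⟨d, p⟩ h
    simp only [mem_sigma] at h
    simp only [Nat.div_mul_cancel (Nat.dvd_of_mem_primeFactors h.2)]
  · rintro ⟨m, p⟩ h
    simp only [mem_sigma, mem_filter, Nat.mem_primesLE] at h
    simp only [Nat.mul_div_cancel m h.2.1.2.pos]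
  · rintro ⟨d, p⟩ h
    rfl

theorem log_eq_sum_log_primeFactors {d : ℕ} (hd : Squarefree d) :
    Real.log d = ∑ p ∈ d.primeFactors, Real.log p := by
  conv_lhs => rw [← Nat.prod_primeFactors_of_squarefree hd]
  push_cast
  exact Real.log_prod fun p hp => by
    have := (Nat.prime_of_mem_primeFactors hp).pos
    positivity

theorem pow_cardDistinctFactors_eq_mul_pow_div {R : Type*} [CommSemiring R] (w : R) {d p : ℕ}
    (hd : Squarefree d) (hp : p ∈ d.primeFactors) :
    w ^ ArithmeticFunction.cardDistinctFactors d =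
      w * w ^ ArithmeticFunction.cardDistinctFactors (d / p) := by
  have hpp := Nat.prime_of_mem_primeFactors hp
  obtain ⟨m, rfl⟩ := Nat.dvd_of_mem_primeFactors hp
  rw [mul_comm, squarefree_mul_prime_iff hpp] at hd
  rw [Nat.mul_div_cancel_left _ hpp.pos, mul_comm p, cardDistinctFactors_mul_prime hpp hd.2,
    pow_succ']

theorem sum_squarefree_divisors_eq {M : Type*} [AddCommMonoid M] {n : ℕ} (hn : n ≠ 0)
    (f : Finset ℕ → M) :
    ∑ d ∈ n.divisors with Squarefree d, f d.primeFactors = ∑ t ∈ n.primeFactors.powerset, f t := by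
  refine sum_bij' (fun d _ => d.primeFactors) (fun t _ => ∏ p ∈ t, p) ?_ ?_ ?_ ?_ ?_
  · intro d hd
    simp only [mem_filter, Nat.mem_divisors] at hd
    exact mem_powerset.2 (Nat.primeFactors_mono hd.1.1 hn)
  · intro t ht
    rw [mem_powerset] at ht
    have hp : ∀ p ∈ t, p.Prime := fun p hp => Nat.prime_of_mem_primeFactors (ht hp)
    simp only [mem_filter, Nat.mem_divisors]
    refine ⟨⟨(prod_dvd_prod_of_subset _ _ _ ht).trans (Nat.prod_primeFactors_dvd n), hn⟩, ?_⟩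
    exact Finset.squarefree_prod_of_pairwise_isCoprime (fun p h q h' hpq => by
      exact (Nat.coprime_iff_isRelPrime.1 ((Nat.coprime_primes (hp p h) (hp q h')).2 hpq))) fun p h => (hp p h).prime.squarefree
  · intro d hd
    simp only [mem_filter] at hd
    exact Nat.prod_primeFactors_of_squarefree hd.2
  · intro t ht
    rw [mem_powerset] at ht
    exact Nat.primeFactors_prod fun p hp => Nat.prime_of_mem_primeFactors (ht hp)
  · intro d hd
    rfl

/-- Expand the product of 1 + w over the primes dividing n: subsets of those primes are the
squarefree divisors. -/
theorem one_add_pow_cardDistinctFactors {R : Type*} [CommSemiring R] (w : R) {n : ℕ} (hn : n ≠ 0) :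
    (1 + w) ^ ArithmeticFunction.cardDistinctFactors n =
      ∑ d ∈ n.divisors with Squarefree d, w ^ ArithmeticFunction.cardDistinctFactors d := by
  simp only [cardDistinctFactors_eq_card_primeFactors]
  rw [sum_squarefree_divisors_eq hn fun t => w ^ t.card, ← prod_const, prod_one_add]
  simp only [prod_const]

theorem sum_one_add_pow_cardDistinctFactors {R : Type*} [CommSemiring R] (w : R) (N : ℕ) :
    ∑ n ∈ Icc 1 N, (1 + w) ^ ArithmeticFunction.cardDistinctFactors n =
      ∑ d ∈ squarefreeUpTo N, ((N / d : ℕ) : R) * w ^ ArithmeticFunction.cardDistinctFactors d := by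
  have h : ∀ n ∈ Icc 1 N, (1 + w) ^ ArithmeticFunction.cardDistinctFactors n =
      ∑ d ∈ squarefreeUpTo N, if d ∣ n then w ^ ArithmeticFunction.cardDistinctFactors d else 0 := by
    intro n hn
    rw [mem_Icc] at hn
    rw [one_add_pow_cardDistinctFactors w (by omega), ← sum_filter]
    refine sum_congr ?_ fun _ _ => rfl
    ext d
    simp only [mem_filter, Nat.mem_divisors, mem_squarefreeUpTo]
    exact ⟨fun h => ⟨⟨(Nat.le_of_dvd (by omega) h.1.1).trans hn.2, h.2⟩, h.1.1⟩,
      fun h => ⟨⟨h.2, by omega⟩, h.1.2⟩⟩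
  rw [sum_congr rfl h, sum_comm]
  refine sum_congr rfl fun d _ => ?_
  rw [← sum_filter, sum_const, nsmul_eq_mul, ← Nat.Ioc_filter_dvd_card_eq_div]
  rfl

/-! ### Upper bounds for sums with nonnegative weights -/

/-- Every squarefree d ≤ N is a product of distinct primes up to N, so the finite Euler product of
the factors 1 + h/p is a majorant. -/
theorem sum_squarefreeUpTo_div_le_exp {h : ℝ} (h0 : 0 ≤ h) (N : ℕ) :
    ∑ d ∈ squarefreeUpTo N, h ^ ArithmeticFunction.cardDistinctFactors d / (d : ℝ) ≤
      Real.exp (h * ∑ p ∈ N.primesLE, 1 / (p : ℝ)) := by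
  calc ∑ d ∈ squarefreeUpTo N, h ^ ArithmeticFunction.cardDistinctFactors d / (d : ℝ)
      = ∑ d ∈ squarefreeUpTo N, ∏ p ∈ d.primeFactors, (h / p) := by
        refine sum_congr rfl fun d hd => ?_
        rw [prod_div_distrib, prod_const, cardDistinctFactors_eq_card_primeFactors,
          ← Nat.cast_prod, Nat.prod_primeFactors_of_squarefree (mem_squarefreeUpTo.1 hd).2]
    _ = ∑ t ∈ (squarefreeUpTo N).image Nat.primeFactors, ∏ p ∈ t, (h / p) := by
        rw [sum_image]
        intro d hd e he hde
        have h1 := Nat.prod_primeFactors_of_squarefree (mem_squarefreeUpTo.1 hd).2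
        have h2 := Nat.prod_primeFactors_of_squarefree (mem_squarefreeUpTo.1 he).2
        rw [← h1, ← h2, hde]
    _ ≤ ∑ t ∈ N.primesLE.powerset, ∏ p ∈ t, (h / p) := by
        refine sum_le_sum_of_subset_of_nonneg ?_ fun t _ _ => prod_nonneg fun p _ => by positivity
        intro t ht
        obtain ⟨d, hd, rfl⟩ := mem_image.1 ht
        refine mem_powerset.2 fun p hp => Nat.mem_primesLE.2 ⟨?_, Nat.prime_of_mem_primeFactors hp⟩
        exact (Nat.le_of_mem_primeFactors hp).trans (mem_squarefreeUpTo.1 hd).1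
    _ = ∏ p ∈ N.primesLE, (1 + h / p) := (prod_one_add _).symm
    _ ≤ ∏ p ∈ N.primesLE, Real.exp (h / p) :=
        prod_le_prod (fun p _ => by positivity) fun p _ => by
          rw [add_comm]; exact Real.add_one_le_exp _
    _ = Real.exp (h * ∑ p ∈ N.primesLE, 1 / (p : ℝ)) := by
        rw [← Real.exp_sum, mul_sum]
        simp only [mul_one_div]

/-- Split log N = log d + log(N/d). In the first part write d = mp and bound the sum over p by
θ(N/m) ≤ (log 4) N/m; in the second use log(N/d) ≤ N/d. This saves a factor log N over the trivial
bound, as is needed for the rounding error in ⌊N/d⌋. -/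
theorem sum_squarefreeUpTo_mul_log_le {h : ℝ} (h0 : 0 ≤ h) (h1 : h ≤ 1) (N : ℕ) :
    (∑ d ∈ squarefreeUpTo N, h ^ ArithmeticFunction.cardDistinctFactors d) * Real.log N ≤
      (1 + Real.log 4) * N *
        ∑ d ∈ squarefreeUpTo N, h ^ ArithmeticFunction.cardDistinctFactors d / (d : ℝ) := by
  have h4 : 0 ≤ Real.log 4 := Real.log_nonneg (by norm_num)
  have e1 : ∑ d ∈ squarefreeUpTo N, h ^ ArithmeticFunction.cardDistinctFactors d * Real.log d ≤
      Real.log 4 * N *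
        ∑ d ∈ squarefreeUpTo N, h ^ ArithmeticFunction.cardDistinctFactors d / (d : ℝ) := by
    calc ∑ d ∈ squarefreeUpTo N, h ^ ArithmeticFunction.cardDistinctFactors d * Real.log d
        = ∑ d ∈ squarefreeUpTo N, ∑ p ∈ d.primeFactors,
          h * h ^ ArithmeticFunction.cardDistinctFactors (d / p) * Real.log p := by
          refine sum_congr rfl fun d hd => ?_
          rw [log_eq_sum_log_primeFactors (mem_squarefreeUpTo.1 hd).2, mul_sum]
          exact sum_congr rfl fun p hp => by
            rw [pow_cardDistinctFactors_eq_mul_pow_div h (mem_squarefreeUpTo.1 hd).2 hp]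
      _ = ∑ m ∈ squarefreeUpTo N, ∑ p ∈ (N / m).primesLE with ¬ p ∣ m,
          h * h ^ ArithmeticFunction.cardDistinctFactors m * Real.log p :=
          sum_squarefreeUpTo_sum_primeFactors N fun p m =>
            h * h ^ ArithmeticFunction.cardDistinctFactors m * Real.log p
      _ ≤ ∑ m ∈ squarefreeUpTo N,
          h ^ ArithmeticFunction.cardDistinctFactors m * (Real.log 4 * (N / m)) := by
          refine sum_le_sum fun m hm => ?_
          have hlog : ∀ p ∈ (N / m).primesLE, 0 ≤ Real.log p := fun p hp =>
            Real.log_nonneg (by exact_mod_cast (Nat.mem_primesLE.1 hp).2.one_le)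
          rw [← mul_sum]
          have hm0 := pos_of_mem_squarefreeUpTo hm
          have ht : ∑ p ∈ (N / m).primesLE with ¬ p ∣ m, Real.log p ≤ Real.log 4 * (N / m) := by
            refine (sum_le_sum_of_subset_of_nonneg (filter_subset _ _)
              fun p hp _ => hlog p hp).trans ?_
            rw [← Chebyshev.theta_eq_sum_primesLE_log]
            exact (Chebyshev.theta_le_log4_mul_x (by positivity)).trans
              (mul_le_mul_of_nonneg_left Nat.cast_div_le h4)
          refine mul_le_mul (mul_le_of_le_one_left (by positivity) h1) ht
            (sum_nonneg fun p hp => hlog p (mem_filter.1 hp).1) (by positivity)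
      _ = Real.log 4 * N *
        ∑ d ∈ squarefreeUpTo N, h ^ ArithmeticFunction.cardDistinctFactors d / (d : ℝ) := by
          rw [mul_sum]
          exact sum_congr rfl fun m _ => by ring
  have e2 : ∑ d ∈ squarefreeUpTo N, h ^ ArithmeticFunction.cardDistinctFactors d *
      (Real.log N - Real.log d) ≤
      N * ∑ d ∈ squarefreeUpTo N, h ^ ArithmeticFunction.cardDistinctFactors d / (d : ℝ) := by
    rw [mul_sum]
    refine sum_le_sum fun d hd => ?_
    have hd0 : (0 : ℝ) < d := by exact_mod_cast pos_of_mem_squarefreeUpTo hd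
    have hN0 : (0 : ℝ) < N := by
      exact_mod_cast (pos_of_mem_squarefreeUpTo hd).trans_le (mem_squarefreeUpTo.1 hd).1
    rw [← Real.log_div hN0.ne' hd0.ne']
    have := Real.log_le_sub_one_of_pos (div_pos hN0 hd0)
    calc h ^ ArithmeticFunction.cardDistinctFactors d * Real.log (N / d)
        ≤ h ^ ArithmeticFunction.cardDistinctFactors d * (N / d) :=
          mul_le_mul_of_nonneg_left (by linarith) (by positivity)
      _ = _ := by ring
  simp only [mul_sub, sum_sub_distrib, ← sum_mul] at e2
  linarith

theorem exists_sum_squarefreeUpTo_div_le_rpow :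
    ∃ C : ℝ, 0 < C ∧ ∀ h u : ℝ, 0 ≤ h → h ≤ 1 → 1 ≤ u →
      ∑ d ∈ squarefreeUpTo ⌊Real.exp u⌋₊,
        h ^ ArithmeticFunction.cardDistinctFactors d / (d : ℝ) ≤ C * u ^ h := by
  obtain ⟨C, hC, hM⟩ := exists_abs_sum_one_div_prime_sub_loglog_sub_le
  refine ⟨Real.exp (C + |meisselMertens|), Real.exp_pos _, fun h u h0 h1 hu => ?_⟩
  have hexp : 2 ≤ Real.exp u := by have := Real.add_one_le_exp u; linarith
  have hb := hM (Real.exp u) hexp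
  rw [Real.log_exp] at hb
  have hb2 := (abs_le.1 (hb.trans (div_le_self hC.le hu))).2
  refine (sum_squarefreeUpTo_div_le_exp h0 _).trans ?_
  rw [Real.rpow_def_of_pos (by linarith), ← Real.exp_add]
  refine Real.exp_le_exp.2 ?_
  have hK : 0 ≤ C + |meisselMertens| := by positivity
  calc h * ∑ p ∈ ⌊Real.exp u⌋₊.primesLE, 1 / (p : ℝ)
      ≤ h * (Real.log u + (C + |meisselMertens|)) :=
        mul_le_mul_of_nonneg_left (by linarith [le_abs_self meisselMertens]) h0
    _ ≤ _ := by nlinarith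

theorem sum_squarefreeUpTo_div_mul_log (w : ℂ) (N : ℕ) :
    ∑ d ∈ squarefreeUpTo N, w ^ ArithmeticFunction.cardDistinctFactors d / (d : ℂ) * Real.log d =
      ∑ m ∈ squarefreeUpTo N, w * (w ^ ArithmeticFunction.cardDistinctFactors m / (m : ℂ)) *
        ((∑ p ∈ (N / m).primesLE with ¬ p ∣ m, Real.log p / (p : ℝ) : ℝ) : ℂ) := by
  have h := sum_squarefreeUpTo_sum_primeFactors N fun p m =>
    w * (w ^ ArithmeticFunction.cardDistinctFactors m / (m : ℂ)) * ((Real.log p / (p : ℝ) : ℝ) : ℂ)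
  simp only [← mul_sum] at h
  simp only [Complex.ofReal_sum]
  rw [← h]
  refine sum_congr rfl fun d hd => ?_
  rw [log_eq_sum_log_primeFactors (mem_squarefreeUpTo.1 hd).2, Complex.ofReal_sum, mul_sum]
  refine sum_congr rfl fun p hp => ?_
  rw [pow_cardDistinctFactors_eq_mul_pow_div w (mem_squarefreeUpTo.1 hd).2 hp]
  have hpp := Nat.prime_of_mem_primeFactors hp
  have e : (d : ℂ) = ((d / p : ℕ) : ℂ) * p := by
    exact_mod_cast (Nat.div_mul_cancel (Nat.dvd_of_mem_primeFactors hp)).symm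
  rw [e]
  push_cast
  have hp0 : (p : ℂ) ≠ 0 := by exact_mod_cast hpp.ne_zero
  have hd0 : ((d / p : ℕ) : ℂ) ≠ 0 := by
    have := Nat.div_pos (Nat.le_of_mem_primeFactors hp) hpp.pos
    exact_mod_cast this.ne'
  field_simp

/-- Removing p from d leaves the weight log p/p², whose sum converges. This pays for the condition p
∤ m created by the reindexing. -/
theorem exists_sum_squarefreeUpTo_sum_log_div_le :
    ∃ C : ℝ, 0 < C ∧ ∀ (h : ℝ) (N : ℕ), 0 ≤ h → h ≤ 1 →
      ∑ d ∈ squarefreeUpTo N, h ^ ArithmeticFunction.cardDistinctFactors d / (d : ℝ) *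
        ∑ p ∈ d.primeFactors, Real.log p / p ≤
      C * ∑ d ∈ squarefreeUpTo N, h ^ ArithmeticFunction.cardDistinctFactors d / (d : ℝ) := by
  obtain ⟨C, hC, hsum⟩ := exists_sum_log_div_mul_pred_le
  refine ⟨C, hC, fun h N h0 h1 => ?_⟩
  have hlog : ∀ p : ℕ, 0 ≤ Real.log p := fun p => Real.log_natCast_nonneg p
  calc ∑ d ∈ squarefreeUpTo N, h ^ ArithmeticFunction.cardDistinctFactors d / (d : ℝ) *
        ∑ p ∈ d.primeFactors, Real.log p / p
      = ∑ d ∈ squarefreeUpTo N, ∑ p ∈ d.primeFactors,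
          h * (h ^ ArithmeticFunction.cardDistinctFactors (d / p) / ((d / p : ℕ) : ℝ)) *
            (Real.log p / (p : ℝ) ^ 2) := by
        refine sum_congr rfl fun d hd => ?_
        rw [mul_sum]
        refine sum_congr rfl fun p hp => ?_
        rw [pow_cardDistinctFactors_eq_mul_pow_div h (mem_squarefreeUpTo.1 hd).2 hp]
        have hpp := Nat.prime_of_mem_primeFactors hp
        have e : (d : ℝ) = ((d / p : ℕ) : ℝ) * p := by
          exact_mod_cast (Nat.div_mul_cancel (Nat.dvd_of_mem_primeFactors hp)).symm
        have hp0 : (p : ℝ) ≠ 0 := by exact_mod_cast hpp.ne_zero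
        have hd0 : ((d / p : ℕ) : ℝ) ≠ 0 := by
          have := Nat.div_pos (Nat.le_of_mem_primeFactors hp) hpp.pos
          exact_mod_cast this.ne'
        rw [e]
        field_simp
    _ = ∑ m ∈ squarefreeUpTo N, ∑ p ∈ (N / m).primesLE with ¬ p ∣ m,
          h * (h ^ ArithmeticFunction.cardDistinctFactors m / (m : ℝ)) *
            (Real.log p / (p : ℝ) ^ 2) :=
        sum_squarefreeUpTo_sum_primeFactors N fun p m =>
          h * (h ^ ArithmeticFunction.cardDistinctFactors m / (m : ℝ)) *
            (Real.log p / (p : ℝ) ^ 2)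
    _ ≤ ∑ m ∈ squarefreeUpTo N,
          C * (h ^ ArithmeticFunction.cardDistinctFactors m / (m : ℝ)) := by
        refine sum_le_sum fun m _ => ?_
        rw [← mul_sum, mul_comm C]
        refine mul_le_mul (mul_le_of_le_one_left (by positivity) h1) ?_
          (sum_nonneg fun p _ => div_nonneg (hlog p) (by positivity)) (by positivity)
        have hmem : ∀ p ∈ (N / m).primesLE.filter (fun p => ¬ p ∣ m), 2 ≤ p := fun p hp =>
          (Nat.mem_primesLE.1 (mem_filter.1 hp).1).2.two_le
        refine (sum_le_sum fun p hp => ?_).trans (hsum _ hmem)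
        have hp2 : (2 : ℝ) ≤ p := by exact_mod_cast hmem p hp
        exact div_le_div_of_nonneg_left (hlog p) (by nlinarith) (by nlinarith)
    _ = _ := (mul_sum _ _ _).symm

/-! ### Complex weights: the approximate differential equation -/

/-- Write u = log d + (u - log d). With d = mp, the first part becomes w times a sum over m of prime
sums ∑ log p/p up to e^u/m, each u - log m + O(1) by Mertens apart from the primes dividing m. If
S(u) is the first sum and J(u) the one weighted by u - log d, then J' = S, so the estimate reads uJ'
= (1+w)J + O(u^|w|). -/
theorem exists_norm_sum_mul_sub_sum_mul_sub_log_le :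
    ∃ K : ℝ, 0 < K ∧ ∀ (w : ℂ) (u : ℝ), ‖w‖ ≤ 1 → 1 ≤ u →
      ‖(∑ d ∈ squarefreeUpTo ⌊Real.exp u⌋₊,
          w ^ ArithmeticFunction.cardDistinctFactors d / (d : ℂ)) * u -
        (1 + w) * ∑ d ∈ squarefreeUpTo ⌊Real.exp u⌋₊,
          w ^ ArithmeticFunction.cardDistinctFactors d / (d : ℂ) * ((u - Real.log d : ℝ) : ℂ)‖ ≤
        K * u ^ ‖w‖ := by
  obtain ⟨C, hC, hsum⟩ := exists_sum_squarefreeUpTo_div_le_rpow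
  obtain ⟨C₁, hC₁, hmert⟩ := exists_abs_sum_log_div_sub_log_le
  obtain ⟨C₂, hC₂, hpf⟩ := exists_sum_squarefreeUpTo_sum_log_div_le
  refine ⟨(C₁ + C₂) * C, by positivity, fun w u hw hu => ?_⟩
  set N := ⌊Real.exp u⌋₊ with hN
  set c : ℕ → ℂ := fun d => w ^ ArithmeticFunction.cardDistinctFactors d / (d : ℂ) with hc
  have hcn : ∀ d, ‖c d‖ = ‖w‖ ^ ArithmeticFunction.cardDistinctFactors d / (d : ℝ) := fun d => by
    simp [hc]
  have e : (∑ d ∈ squarefreeUpTo N, c d) * u -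
      (1 + w) * ∑ d ∈ squarefreeUpTo N, c d * ((u - Real.log d : ℝ) : ℂ) =
      ∑ m ∈ squarefreeUpTo N, w * c m *
        (((∑ p ∈ (N / m).primesLE with ¬ p ∣ m, Real.log p / (p : ℝ)) -
          (u - Real.log m) : ℝ) : ℂ) := by
    have h1 := sum_squarefreeUpTo_div_mul_log w N
    have h2 : ∑ m ∈ squarefreeUpTo N, w * c m *
        (((∑ p ∈ (N / m).primesLE with ¬ p ∣ m, Real.log p / (p : ℝ)) -
          (u - Real.log m) : ℝ) : ℂ) =
        ∑ d ∈ squarefreeUpTo N, c d * Real.log d -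
          w * ∑ d ∈ squarefreeUpTo N, c d * ((u - Real.log d : ℝ) : ℂ) := by
      rw [h1, mul_sum, ← sum_sub_distrib]
      refine sum_congr rfl fun m _ => ?_
      rw [Complex.ofReal_sub]
      ring
    rw [h2, add_mul, one_mul, ← sub_sub]
    congr 1
    rw [sum_mul, ← sum_sub_distrib]
    refine sum_congr rfl fun d _ => ?_
    rw [Complex.ofReal_sub]
    ring
  rw [e]
  have hlog : ∀ p : ℕ, 0 ≤ Real.log p / p := fun p =>
    div_nonneg (Real.log_natCast_nonneg p) (by positivity)
  have hterm : ∀ m ∈ squarefreeUpTo N,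
      |(∑ p ∈ (N / m).primesLE with ¬ p ∣ m, Real.log p / (p : ℝ)) - (u - Real.log m)| ≤
        C₁ + ∑ p ∈ m.primeFactors, Real.log p / p := by
    intro m hm
    have hm0 : (0 : ℝ) < m := by exact_mod_cast pos_of_mem_squarefreeUpTo hm
    have hmN : (m : ℝ) ≤ Real.exp u :=
      (Nat.le_floor_iff (Real.exp_pos u).le).1 (mem_squarefreeUpTo.1 hm).1
    have h1 := hmert (Real.exp u / m) ((one_le_div hm0).2 hmN)
    rw [Nat.floor_div_natCast, Real.log_div (Real.exp_pos u).ne' hm0.ne', Real.log_exp] at h1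
    have h2 := sum_filter_add_sum_filter_not (N / m).primesLE (fun p => p ∣ m)
      fun p => Real.log p / (p : ℝ)
    have h3 : ∑ p ∈ (N / m).primesLE with p ∣ m, Real.log p / (p : ℝ) ≤
        ∑ p ∈ m.primeFactors, Real.log p / p :=
      sum_le_sum_of_subset_of_nonneg (fun p hp => by
        rw [mem_filter, Nat.mem_primesLE] at hp
        exact Nat.mem_primeFactors.2 ⟨hp.1.2, hp.2, (pos_of_mem_squarefreeUpTo hm).ne'⟩)
        fun p _ _ => hlog p
    have h4 : 0 ≤ ∑ p ∈ (N / m).primesLE with p ∣ m, Real.log p / (p : ℝ) :=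
      sum_nonneg fun p _ => hlog p
    rw [← h2] at h1
    rw [abs_le] at h1 ⊢
    constructor <;> linarith [h1.1, h1.2]
  calc ‖∑ m ∈ squarefreeUpTo N, w * c m *
        (((∑ p ∈ (N / m).primesLE with ¬ p ∣ m, Real.log p / (p : ℝ)) -
          (u - Real.log m) : ℝ) : ℂ)‖
      ≤ ∑ m ∈ squarefreeUpTo N, ‖w‖ ^ ArithmeticFunction.cardDistinctFactors m / (m : ℝ) *
          (C₁ + ∑ p ∈ m.primeFactors, Real.log p / p) := by
        refine norm_sum_le_of_le _ fun m hm => ?_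
        rw [norm_mul, norm_mul, hcn, Complex.norm_real, Real.norm_eq_abs]
        exact mul_le_mul (mul_le_of_le_one_left (by positivity) hw) (hterm m hm) (abs_nonneg _)
          (by positivity)
    _ ≤ (C₁ + C₂) * ∑ m ∈ squarefreeUpTo N,
          ‖w‖ ^ ArithmeticFunction.cardDistinctFactors m / (m : ℝ) := by
        simp only [mul_add, sum_add_distrib]
        have := hpf ‖w‖ N (norm_nonneg _) hw
        rw [← sum_mul]
        linarith
    _ ≤ (C₁ + C₂) * C * u ^ ‖w‖ := by
        rw [mul_assoc]
        exact mul_le_mul_of_nonneg_left (hsum _ _ (norm_nonneg _) hw hu) (by positivity)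

/-- The right derivative at the kink v = a is 1, which matches the closed condition log d ≤ v in the
sums. -/
theorem hasDerivWithinAt_max_zero_sub (a v : ℝ) :
    HasDerivWithinAt (fun v : ℝ => max 0 (v - a)) (if a ≤ v then 1 else 0) (Set.Ici v) v := by
  split_ifs with h
  · refine ((hasDerivWithinAt_id v (Set.Ici v)).sub_const a).congr (fun t ht => ?_) ?_
    · exact max_eq_right (by linarith [Set.mem_Ici.1 ht])
    · exact max_eq_right (by linarith)
  · push Not at h
    refine ((hasDerivAt_const v (0 : ℝ)).congr_of_eventuallyEq ?_).hasDerivWithinAt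
    filter_upwards [gt_mem_nhds h] with t ht
    exact max_eq_left (by linarith)

theorem filter_log_le_squarefreeUpTo {u v : ℝ} (h : v ≤ u) :
    (squarefreeUpTo ⌊Real.exp u⌋₊).filter (fun d : ℕ => Real.log d ≤ v) =
      squarefreeUpTo ⌊Real.exp v⌋₊ := by
  ext d
  simp only [mem_filter, mem_squarefreeUpTo]
  have hiff : Squarefree d → (Real.log d ≤ v ↔ d ≤ ⌊Real.exp v⌋₊) := fun hd => by
    rw [Nat.le_floor_iff (Real.exp_pos v).le, Real.log_le_iff_le_exp]
    exact_mod_cast Nat.pos_of_ne_zero hd.ne_zero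
  exact ⟨fun ⟨⟨_, h2⟩, h3⟩ => ⟨(hiff h2).1 h3, h2⟩,
    fun ⟨h1, h2⟩ => ⟨⟨h1.trans (Nat.floor_mono (Real.exp_le_exp.2 h)), h2⟩, (hiff h2).2 h1⟩⟩

/-- Multiplying J by v^(-(1+w)) leaves a derivative of size at most K v^(|w| - Re w - 2) ≤ K
v^(-3/2), because |w| - Re w ≤ 1/2. This is integrable at infinity, so J(U) ≪ U^(1 + Re w), and the
differential equation returns the bound for S. -/
theorem exists_norm_sum_squarefreeUpTo_div_le :
    ∃ K : ℝ, 0 < K ∧ ∀ (w : ℂ) (u : ℝ), ‖w‖ ≤ 1 / 4 → 1 ≤ u →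
      ‖∑ d ∈ squarefreeUpTo ⌊Real.exp u⌋₊,
          w ^ ArithmeticFunction.cardDistinctFactors d / (d : ℂ)‖ ≤ K * u ^ w.re := by
  obtain ⟨C, hC, hsum⟩ := exists_sum_squarefreeUpTo_div_le_rpow
  obtain ⟨K, hK, hdiff⟩ := exists_norm_sum_mul_sub_sum_mul_sub_log_le
  refine ⟨2 * (C + 2 * K) + K, by positivity, fun w U hw hU => ?_⟩
  have hre := (abs_le.1 ((Complex.abs_re_le_norm w).trans hw))
  set c : ℕ → ℂ := fun d => w ^ ArithmeticFunction.cardDistinctFactors d / (d : ℂ) with hc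
  set X := ⌊Real.exp U⌋₊ with hX
  set S : ℝ → ℂ := fun v => ∑ d ∈ squarefreeUpTo ⌊Real.exp v⌋₊, c d with hS
  -- Truncating with `max` keeps the index set fixed as v varies, so J is continuous and has a right
  -- derivative everywhere.
  set J : ℝ → ℂ := fun v => ∑ d ∈ squarefreeUpTo X, ((max 0 (v - Real.log d) : ℝ) : ℂ) * c d with hJ
  have hJeq : ∀ v, v ≤ U → J v =
      ∑ d ∈ squarefreeUpTo ⌊Real.exp v⌋₊, c d * ((v - Real.log d : ℝ) : ℂ) := by
    intro v hv
    rw [← filter_log_le_squarefreeUpTo hv, sum_filter]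
    refine sum_congr rfl fun d _ => ?_
    split_ifs with h
    · rw [max_eq_right (by linarith), mul_comm]
    · rw [max_eq_left (by linarith)]; simp
  have hJd : ∀ v, v ≤ U → HasDerivWithinAt J (S v) (Set.Ici v) v := by
    intro v hv
    have h1 : S v = ∑ d ∈ squarefreeUpTo X,
        (((if Real.log d ≤ v then 1 else 0 : ℝ)) : ℂ) * c d := by
      simp only [hS]
      rw [← filter_log_le_squarefreeUpTo hv, sum_filter]
      refine sum_congr rfl fun d _ => ?_
      split_ifs <;> simp
    rw [h1]
    exact HasDerivWithinAt.fun_sum fun d _ =>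
      ((hasDerivWithinAt_max_zero_sub (Real.log d) v).ofReal_comp).mul_const (c d)
  have hJcont : Continuous J := by
    refine continuous_finsetSum _ fun d _ => Continuous.mul ?_ continuous_const
    exact Complex.continuous_ofReal.comp (by fun_prop)
  have hdJ : ∀ v, 1 ≤ v → v ≤ U → ‖S v * v - (1 + w) * J v‖ ≤ K * v ^ ‖w‖ := fun v h1 h2 => by
    rw [hJeq v h2]
    exact hdiff w v (by linarith) h1
  have hw1 : -(1 + w) ≠ 0 := by
    intro h
    have h2 := congrArg Complex.re h
    simp only [Complex.neg_re, Complex.add_re, Complex.one_re, Complex.zero_re] at h2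
    linarith [hre.1]
  have hcpow : ∀ v : ℝ, 1 ≤ v →
      HasDerivAt (fun y : ℝ => (y : ℂ) ^ (-(1 + w))) (-(1 + w) * (v : ℂ) ^ (-(1 + w) - 1)) v :=
    fun v hv => hasDerivAt_ofReal_cpow_const (by linarith) hw1
  -- The barrier is C plus the integral of K t^(-3/2) from 1 to v. It starts at C, which bounds J(1)
  -- since 0 ≤ 1 - log d ≤ 1 there.
  have hfence := image_norm_le_of_norm_deriv_right_le_deriv_boundary' (a := 1) (b := U)
    (f := fun v => J v * (v : ℂ) ^ (-(1 + w)))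
    (f' := fun v => S v * (v : ℂ) ^ (-(1 + w)) + J v * (-(1 + w) * (v : ℂ) ^ (-(1 + w) - 1)))
    (B := fun v => C + 2 * K - 2 * K * v ^ (-(1 / 2) : ℝ))
    (B' := fun v => -(2 * K * (-(1 / 2) * v ^ (-(1 / 2) - 1 : ℝ))))
    (hJcont.continuousOn.mul fun v hv => (hcpow v hv.1).continuousAt.continuousWithinAt)
    (fun v hv => (hJd v hv.2.le).mul (hcpow v hv.1).hasDerivWithinAt)
    (by
      simp only [Complex.ofReal_one, Complex.one_cpow, mul_one, Real.one_rpow]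
      rw [hJeq 1 hU]
      have h1 := hsum ‖w‖ 1 (norm_nonneg _) (by linarith) le_rfl
      rw [Real.one_rpow, mul_one] at h1
      refine le_trans (norm_sum_le_of_le (n := fun d =>
        ‖w‖ ^ ArithmeticFunction.cardDistinctFactors d / (d : ℝ)) _ fun d hd => ?_)
        (h1.trans (by linarith))
      have hd0 : (0 : ℝ) < d := by exact_mod_cast pos_of_mem_squarefreeUpTo hd
      have hd1 : 0 ≤ Real.log d := Real.log_natCast_nonneg d
      have hd2 : Real.log d ≤ 1 := (Real.log_le_iff_le_exp hd0).2
        ((Nat.le_floor_iff (Real.exp_pos 1).le).1 (mem_squarefreeUpTo.1 hd).1)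
      rw [norm_mul, Complex.norm_real, Real.norm_eq_abs, abs_of_nonneg (by linarith)]
      simp only [hc, norm_div, norm_pow, Complex.norm_natCast]
      exact mul_le_of_le_one_right (by positivity) (by linarith))
    (fun v hv => by
      have hv0 : v ≠ 0 := by linarith [hv.1]
      refine ContinuousAt.continuousWithinAt ?_
      exact continuousAt_const.sub (continuousAt_const.mul
        (Real.continuousAt_rpow_const v _ (Or.inl hv0))))
    (fun v hv => by
      have hv0 : v ≠ 0 := by linarith [hv.1]
      exact (((Real.hasDerivAt_rpow_const (Or.inl hv0)).const_mul (2 * K)).const_sub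
        (C + 2 * K)).hasDerivWithinAt)
    (fun v hv => by
      have hv0 : 0 < v := by linarith [hv.1]
      have hvc : (v : ℂ) ≠ 0 := by exact_mod_cast hv0.ne'
      have e : S v * (v : ℂ) ^ (-(1 + w)) + J v * (-(1 + w) * (v : ℂ) ^ (-(1 + w) - 1)) =
          (S v * v - (1 + w) * J v) * (v : ℂ) ^ (-(1 + w) - 1) := by
        have : (v : ℂ) ^ (-(1 + w)) = v * (v : ℂ) ^ (-(1 + w) - 1) := by
          rw [Complex.cpow_sub _ _ hvc, Complex.cpow_one]
          field_simp
        rw [this]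
        ring
      rw [e, norm_mul, Complex.norm_cpow_eq_rpow_re_of_pos hv0]
      have e2 : -(2 * K * (-(1 / 2) * v ^ (-(1 / 2) - 1 : ℝ))) = K * v ^ (-(1 / 2) - 1 : ℝ) := by
        ring
      rw [e2]
      calc ‖S v * v - (1 + w) * J v‖ * v ^ (-(1 + w) - 1).re
          ≤ K * v ^ ‖w‖ * v ^ (-(1 + w) - 1).re :=
            mul_le_mul_of_nonneg_right (hdJ v hv.1 hv.2.le) (by positivity)
        _ = K * v ^ (‖w‖ + (-(1 + w) - 1).re) := by rw [mul_assoc, ← Real.rpow_add hv0]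
        _ ≤ _ := by
          refine mul_le_mul_of_nonneg_left (Real.rpow_le_rpow_of_exponent_le hv.1 ?_) hK.le
          simp only [Complex.sub_re, Complex.neg_re, Complex.add_re, Complex.one_re]
          linarith [hre.1])
    (show U ∈ Set.Icc 1 U from ⟨hU, le_rfl⟩)
  have hU0 : 0 < U := by linarith
  have hUr : 0 < U ^ w.re := by positivity
  simp only [norm_mul, Complex.norm_cpow_eq_rpow_re_of_pos hU0] at hfence
  have hJU : ‖J U‖ ≤ (C + 2 * K) * (U * U ^ w.re) := by
    have e : (-(1 + w)).re = -(1 + w.re) := by simp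
    rw [e, Real.rpow_neg hU0.le, Real.rpow_add hU0, Real.rpow_one, ← div_eq_mul_inv,
      div_le_iff₀ (by positivity)] at hfence
    refine hfence.trans (mul_le_mul_of_nonneg_right ?_ (by positivity))
    have : 0 ≤ 2 * K * U ^ (-(1 / 2) : ℝ) := by positivity
    linarith
  have hSU : ‖S U * U‖ ≤ (2 * (C + 2 * K) + K) * (U * U ^ w.re) := by
    have h1 : S U * U = (S U * U - (1 + w) * J U) + (1 + w) * J U := by ring
    rw [h1]
    have h2 : ‖1 + w‖ ≤ 2 := (norm_add_le _ _).trans (by rw [norm_one]; linarith)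
    have h3 : U ^ ‖w‖ ≤ U * U ^ w.re := by
      rw [← Real.rpow_one_add' hU0.le (by linarith [hre.1])]
      exact Real.rpow_le_rpow_of_exponent_le hU (by linarith [hre.1])
    calc ‖(S U * U - (1 + w) * J U) + (1 + w) * J U‖
        ≤ K * U ^ ‖w‖ + 2 * ((C + 2 * K) * (U * U ^ w.re)) := by
          refine (norm_add_le _ _).trans (add_le_add (hdJ U hU le_rfl) ?_)
          rw [norm_mul]
          exact mul_le_mul h2 hJU (norm_nonneg _) (by norm_num)
      _ ≤ _ := by nlinarith
  rw [norm_mul, Complex.norm_real, Real.norm_eq_abs, abs_of_pos hU0] at hSU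
  have : U * ‖S U‖ ≤ U * ((2 * (C + 2 * K) + K) * U ^ w.re) := by linarith
  exact le_of_mul_le_mul_left this hU0

/-- Replacing ⌊N/d⌋ by N/d costs at most G/N, where G sums |w|^ω(d). The logarithmic saving gives
G/N ≪ (log x)^(|w| - 1), which is absorbed because |w| - 1 ≤ Re w. -/
theorem exists_norm_mean_one_add_pow_le :
    ∃ K : ℝ, 0 < K ∧ ∀ (w : ℂ) (x : ℝ), ‖w‖ ≤ 1 / 4 → 3 ≤ x →
      ‖(∑ n ∈ Icc 1 ⌊x⌋₊, (1 + w) ^ ArithmeticFunction.cardDistinctFactors n) / (⌊x⌋₊ : ℂ)‖ ≤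
        K * Real.log x ^ w.re := by
  obtain ⟨C, hC, hsum⟩ := exists_sum_squarefreeUpTo_div_le_rpow
  obtain ⟨K, hK, hmain⟩ := exists_norm_sum_squarefreeUpTo_div_le
  have h4 : 0 ≤ Real.log 4 := Real.log_nonneg (by norm_num)
  refine ⟨K + 2 * (1 + Real.log 4) * C, by positivity, fun w x hw hx => ?_⟩
  have hre := (abs_le.1 ((Complex.abs_re_le_norm w).trans hw))
  set N := ⌊x⌋₊ with hN
  set u := Real.log x with hu
  have hx0 : 0 < x := by linarith
  have hexp : Real.exp u = x := Real.exp_log hx0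
  have hu1 : 1 ≤ u := by
    rw [hu, Real.le_log_iff_exp_le hx0]
    linarith [Real.exp_one_lt_d9]
  have hu0 : 0 < u := by linarith
  have hN3 : 3 ≤ N := Nat.le_floor (by exact_mod_cast hx)
  have hN3' : (3 : ℝ) ≤ N := by exact_mod_cast hN3
  have hN0 : (0 : ℝ) < N := by linarith
  have hlogN : u ≤ 2 * Real.log N := by
    rw [← Real.log_rpow hN0]
    refine Real.log_le_log hx0 ?_
    have := (Nat.lt_floor_add_one x).le
    rw [Real.rpow_two]
    nlinarith
  have hmain' := hmain w u hw hu1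
  have hsum' := hsum ‖w‖ u (norm_nonneg _) (by linarith) hu1
  rw [hexp, ← hN] at hmain' hsum'
  have hHT := sum_squarefreeUpTo_mul_log_le (norm_nonneg w) (by linarith) N
  set G := ∑ d ∈ squarefreeUpTo N, ‖w‖ ^ ArithmeticFunction.cardDistinctFactors d with hG
  have hG0 : 0 ≤ G := sum_nonneg fun d _ => by positivity
  have hGN : G / N ≤ 2 * (1 + Real.log 4) * C * u ^ w.re := by
    rw [div_le_iff₀ hN0]
    have h1 : G * u ≤ 2 * ((1 + Real.log 4) * N * (C * u ^ ‖w‖)) :=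
      calc G * u ≤ G * (2 * Real.log N) := mul_le_mul_of_nonneg_left hlogN hG0
        _ = 2 * (G * Real.log N) := by ring
        _ ≤ _ := mul_le_mul_of_nonneg_left
            (hHT.trans (mul_le_mul_of_nonneg_left hsum' (by positivity))) (by norm_num)
    have h3 : u ^ ‖w‖ ≤ u * u ^ w.re := by
      rw [← Real.rpow_one_add' hu0.le (by linarith [hre.1])]
      exact Real.rpow_le_rpow_of_exponent_le hu1 (by linarith [hre.1])
    have h5 : 2 * ((1 + Real.log 4) * N * (C * u ^ ‖w‖)) ≤
        2 * ((1 + Real.log 4) * N * (C * (u * u ^ w.re))) := by gcongr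
    refine le_of_mul_le_mul_right ?_ hu0
    linarith
  rw [sum_one_add_pow_cardDistinctFactors, sum_div]
  have hNc : (N : ℂ) ≠ 0 := by exact_mod_cast hN0.ne'
  have e : ∑ d ∈ squarefreeUpTo N,
      ((N / d : ℕ) : ℂ) * w ^ ArithmeticFunction.cardDistinctFactors d / N =
      ∑ d ∈ squarefreeUpTo N, w ^ ArithmeticFunction.cardDistinctFactors d / (d : ℂ) -
      ∑ d ∈ squarefreeUpTo N, ((((N : ℝ) / d - (N / d : ℕ)) / N : ℝ) : ℂ) *
        w ^ ArithmeticFunction.cardDistinctFactors d := by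
    rw [← sum_sub_distrib]
    refine sum_congr rfl fun d hd => ?_
    have : (d : ℂ) ≠ 0 := by exact_mod_cast (pos_of_mem_squarefreeUpTo hd).ne'
    push_cast
    field_simp
    ring
  rw [e]
  have h2 : ‖∑ d ∈ squarefreeUpTo N, ((((N : ℝ) / d - (N / d : ℕ)) / N : ℝ) : ℂ) *
        w ^ ArithmeticFunction.cardDistinctFactors d‖ ≤ G / N := by
    rw [hG, sum_div]
    refine norm_sum_le_of_le _ fun d hd => ?_
    have hd0 := pos_of_mem_squarefreeUpTo hd
    have hd0' : (0 : ℝ) < d := by exact_mod_cast hd0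
    have h3 : ((N / d : ℕ) : ℝ) ≤ (N : ℝ) / d := Nat.cast_div_le
    have h4 : (N : ℝ) / d ≤ ((N / d : ℕ) : ℝ) + 1 := by
      rw [div_le_iff₀ hd0', mul_comm]
      exact_mod_cast (Nat.lt_mul_div_succ N hd0).le
    rw [norm_mul, norm_pow, Complex.norm_real, Real.norm_eq_abs,
      abs_of_nonneg (div_nonneg (by linarith) hN0.le), div_mul_eq_mul_div]
    exact div_le_div_of_nonneg_right
      (mul_le_of_le_one_left (by positivity) (by linarith)) hN0.le
  calc _ ≤ _ := norm_sub_le _ _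
    _ ≤ K * u ^ w.re + 2 * (1 + Real.log 4) * C * u ^ w.re := add_le_add hmain' (h2.trans hGN)
    _ = _ := by ring

/-! ### The mean of ω -/

theorem sum_cardDistinctFactors_eq (N : ℕ) :
    ∑ n ∈ Icc 1 N, ArithmeticFunction.cardDistinctFactors n = ∑ p ∈ N.primesLE, N / p := by
  have h : ∀ n ∈ Icc 1 N, ArithmeticFunction.cardDistinctFactors n =
      ∑ p ∈ N.primesLE, if p ∣ n then 1 else 0 := by
    intro n hn
    rw [mem_Icc] at hn
    rw [cardDistinctFactors_eq_card_primeFactors, card_eq_sum_ones, ← sum_filter]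
    refine sum_congr ?_ fun _ _ => rfl
    ext p
    simp only [mem_filter, Nat.mem_primesLE, Nat.mem_primeFactors]
    exact ⟨fun h => ⟨⟨(Nat.le_of_dvd (by omega) h.2.1).trans hn.2, h.1⟩, h.2.1⟩,
      fun h => ⟨h.1.2, h.2, by omega⟩⟩
  rw [sum_congr rfl h, sum_comm]
  refine sum_congr rfl fun p _ => ?_
  rw [← sum_filter, ← card_eq_sum_ones, ← Nat.Ioc_filter_dvd_card_eq_div]
  rfl

theorem primeCounting_floor_le {x : ℝ} (hx : 1 < x) :
    (⌊x⌋₊.primeCounting : ℝ) ≤ (2 * Real.log 4 + 2) * (x / Real.log x) := by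
  have h := Chebyshev.pi_le_log4_mul_div hx
  have hx0 : 0 < x := by linarith
  have hlog : 0 < Real.log x := Real.log_pos hx
  rw [Real.log_sqrt hx0.le] at h
  have h1 : √x ≤ 2 * (x / Real.log x) := by
    rw [← mul_div_assoc, le_div_iff₀ hlog]
    have h2 := Real.log_le_rpow_div hx0.le (show (0 : ℝ) < 1 / 2 by norm_num)
    rw [← Real.sqrt_eq_rpow] at h2
    have h3 := Real.mul_self_sqrt hx0.le
    nlinarith [Real.sqrt_nonneg x]
  have e : Real.log 4 * x / (Real.log x / 2) = 2 * Real.log 4 * (x / Real.log x) := by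
    field_simp
  rw [e] at h
  linarith

/-- Dropping the floors in ∑ ⌊N/p⌋ costs π(N)/N = O(1/log x) by Chebyshev; Mertens' theorem does the
rest. -/
theorem exists_abs_mean_cardDistinctFactors_sub_le :
    ∃ K : ℝ, 0 < K ∧ ∀ x : ℝ, 3 ≤ x →
      |(∑ n ∈ Icc 1 ⌊x⌋₊, (ArithmeticFunction.cardDistinctFactors n : ℝ)) / ⌊x⌋₊ -
        Real.log (Real.log x) - meisselMertens| ≤ K / Real.log x := by
  obtain ⟨C, hC, hM⟩ := exists_abs_sum_one_div_prime_sub_loglog_sub_le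
  have h4 : 0 ≤ Real.log 4 := Real.log_nonneg (by norm_num)
  refine ⟨C + 2 * (2 * Real.log 4 + 2), by positivity, fun x hx => ?_⟩
  set N := ⌊x⌋₊ with hN
  have hN3 : 3 ≤ N := Nat.le_floor (by exact_mod_cast hx)
  have hN3' : (3 : ℝ) ≤ N := by exact_mod_cast hN3
  have hN0 : (0 : ℝ) < N := by linarith
  have hlog : 0 < Real.log x := Real.log_pos (by linarith)
  have hxN : x ≤ 2 * N := by
    have := (Nat.lt_floor_add_one x).le
    linarith
  have hdiff : |(∑ n ∈ Icc 1 N, (ArithmeticFunction.cardDistinctFactors n : ℝ)) / N -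
      ∑ p ∈ N.primesLE, 1 / (p : ℝ)| ≤ N.primeCounting / N := by
    rw [← Nat.cast_sum, sum_cardDistinctFactors_eq, Nat.cast_sum, sum_div, ← sum_sub_distrib,
      ← Nat.primesLE_card_eq_primeCounting, card_eq_sum_ones, Nat.cast_sum, sum_div]
    refine (abs_sum_le_sum_abs _ _).trans (sum_le_sum fun p hp => ?_)
    have hp0 := (Nat.mem_primesLE.1 hp).2.pos
    have hp0' : (0 : ℝ) < p := by exact_mod_cast hp0
    have h3 : ((N / p : ℕ) : ℝ) ≤ (N : ℝ) / p := Nat.cast_div_le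
    have h4 : (N : ℝ) / p ≤ ((N / p : ℕ) : ℝ) + 1 := by
      rw [div_le_iff₀ hp0', mul_comm]
      exact_mod_cast (Nat.lt_mul_div_succ N hp0).le
    have e : ((N / p : ℕ) : ℝ) / N - 1 / p = (((N / p : ℕ) : ℝ) - N / p) / N := by
      field_simp
    rw [e, abs_div, abs_of_pos hN0, Nat.cast_one]
    refine div_le_div_of_nonneg_right ?_ hN0.le
    rw [abs_le]
    constructor <;> linarith
  have hpi : (N.primeCounting : ℝ) / N ≤ 2 * (2 * Real.log 4 + 2) / Real.log x := by
    rw [div_le_iff₀ hN0]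
    refine (primeCounting_floor_le (by linarith : 1 < x)).trans ?_
    have : x / Real.log x ≤ 2 * N / Real.log x := div_le_div_of_nonneg_right hxN hlog.le
    calc _ ≤ (2 * Real.log 4 + 2) * (2 * N / Real.log x) :=
          mul_le_mul_of_nonneg_left this (by positivity)
      _ = _ := by ring
  have h1 := hM x (by linarith)
  have h2 := hdiff.trans hpi
  rw [← hN] at h1
  rw [add_div]
  rw [abs_le] at h1 h2 ⊢
  constructor <;> linarith [h1.1, h1.2, h2.1, h2.2]

/-! ### Gaussian moments as derivatives of exp(s²/2) -/

theorem contDiff_cexp_sq_div_two {n : WithTop ℕ∞} : ContDiff ℂ n fun s : ℂ => Complex.exp (s ^ 2 / 2) := by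
  fun_prop

theorem iteratedDeriv_cexp_sq_div_two (k : ℕ) :
    iteratedDeriv k (fun s : ℂ => Complex.exp (s ^ 2 / 2)) 0 = (gaussianMoment k : ℂ) := by
  have h := ProbabilityTheory.iteratedDeriv_complexMGF (X := id)
    (μ := ProbabilityTheory.gaussianReal 0 1) (z := 0) (by simp) k
  have e : ProbabilityTheory.complexMGF id (ProbabilityTheory.gaussianReal 0 1) =
      fun s : ℂ => Complex.exp (s ^ 2 / 2) := by
    ext s
    rw [ProbabilityTheory.complexMGF_id_gaussianReal]
    simp
  rw [e] at h
  rw [h, gaussianMoment, ← integral_complex_ofReal]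
  simp

theorem iteratedDeriv_succ_id_mul {F : ℂ → ℂ} (hF : Differentiable ℂ F) (k : ℕ) :
    iteratedDeriv (k + 1) (fun s => s * F s) 0 = (k + 1) * iteratedDeriv k F 0 := by
  rw [iteratedDeriv_fun_mul (by fun_prop) hF.contDiff.contDiffAt, sum_eq_single 1]
  · simp [iteratedDeriv_one]
  · intro i _ hi
    rcases i with _ | _ | i
    · simp
    · exact absurd rfl hi
    · have : iteratedDeriv (i + 2) (fun s : ℂ => s) 0 = 0 := by
        rw [iteratedDeriv_succ', iteratedDeriv_succ']
        simp
      rw [this]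
      simp
  · intro h
    simp at h

theorem deriv_cexp_sq_div_two :
    deriv (fun s : ℂ => Complex.exp (s ^ 2 / 2)) = fun s => s * Complex.exp (s ^ 2 / 2) := by
  ext s
  have := (((hasDerivAt_id s).pow 2).div_const 2).cexp
  refine this.deriv.trans ?_
  simp
  ring

theorem gaussianMoment_zero : gaussianMoment 0 = 1 := by simp [gaussianMoment]

theorem gaussianMoment_one : gaussianMoment 1 = 0 := by simp [gaussianMoment]

/-- Differentiate e^(s²/2) once to get s e^(s²/2), then apply the Leibniz rule at 0. -/
theorem gaussianMoment_add_two (k : ℕ) : gaussianMoment (k + 2) = (k + 1) * gaussianMoment k := by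
  have h := iteratedDeriv_cexp_sq_div_two (k + 2)
  rw [iteratedDeriv_succ', deriv_cexp_sq_div_two, iteratedDeriv_succ_id_mul (by fun_prop),
    iteratedDeriv_cexp_sq_div_two] at h
  exact_mod_cast h.symm

/-! ### The scale M_k and the Leibniz–Cauchy bound -/

/-- The positive factor `T_k` with `M_k = k! T_k`. -/
noncomputable def scaleFactor (k : ℕ) : ℝ := ((2 : ℝ) ^ ((k : ℝ) / 2) * Real.Gamma ((k : ℝ) / 2 + 1))⁻¹

theorem momentScale_eq (k : ℕ) : momentScale k = k.factorial * scaleFactor k := by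
  rw [momentScale, scaleFactor, div_eq_mul_inv]

theorem scaleFactor_pos (k : ℕ) : 0 < scaleFactor k := by
  have := Real.Gamma_pos_of_pos (show 0 < (k : ℝ) / 2 + 1 by positivity)
  rw [scaleFactor]
  positivity

theorem momentScale_pos (k : ℕ) : 0 < momentScale k := by
  rw [momentScale_eq]
  have := scaleFactor_pos k
  positivity

theorem scaleFactor_eq_mul_add_two (k : ℕ) : scaleFactor k = (k + 2) * scaleFactor (k + 2) := by
  have hG := Real.Gamma_pos_of_pos (show 0 < (k : ℝ) / 2 + 1 by positivity)
  have h1 : ((k + 2 : ℕ) : ℝ) / 2 + 1 = ((k : ℝ) / 2 + 1) + 1 := by push_cast; ring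
  have h2 : (2 : ℝ) ^ (((k + 2 : ℕ) : ℝ) / 2) = 2 ^ ((k : ℝ) / 2) * 2 := by
    rw [show ((k + 2 : ℕ) : ℝ) / 2 = (k : ℝ) / 2 + 1 by push_cast; ring,
      Real.rpow_add (by norm_num), Real.rpow_one]
  have hk : (k : ℝ) + 2 = 2 * ((k : ℝ) / 2 + 1) := by ring
  have hy : 0 < (k : ℝ) / 2 + 1 := by positivity
  rw [scaleFactor, scaleFactor, h1, h2, Real.Gamma_add_one hy.ne', hk]
  generalize Real.Gamma ((k : ℝ) / 2 + 1) = g at hG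
  generalize (k : ℝ) / 2 + 1 = y at hy
  field_simp

/-- Log-convexity of Γ at the midpoint of x and x + 1. -/
theorem Real.Gamma_add_half_le {x : ℝ} (hx : 0 < x) : Real.Gamma (x + 1 / 2) ≤ √x * Real.Gamma x := by
  have h := Real.Gamma_mul_add_mul_le_rpow_Gamma_mul_rpow_Gamma (s := x) (t := x + 1)
    (a := 1 / 2) (b := 1 / 2) hx (by linarith) (by norm_num) (by norm_num) (by norm_num)
  have hG := Real.Gamma_pos_of_pos hx
  rw [show (1 : ℝ) / 2 * x + 1 / 2 * (x + 1) = x + 1 / 2 by ring, Real.Gamma_add_one hx.ne',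
    ← Real.sqrt_eq_rpow, ← Real.sqrt_eq_rpow, Real.sqrt_mul hx.le, mul_left_comm,
    Real.mul_self_sqrt hG.le] at h
  exact h

theorem scaleFactor_le_succ (k : ℕ) : scaleFactor k ≤ √(k + 2) * scaleFactor (k + 1) := by
  have hG := Real.Gamma_pos_of_pos (show 0 < (k : ℝ) / 2 + 1 by positivity)
  have hG' := Real.Gamma_pos_of_pos (show 0 < ((k : ℝ) / 2 + 1) + 1 / 2 by positivity)
  have h1 : ((k + 1 : ℕ) : ℝ) / 2 + 1 = ((k : ℝ) / 2 + 1) + 1 / 2 := by push_cast; ring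
  have h2 : (2 : ℝ) ^ (((k + 1 : ℕ) : ℝ) / 2) = 2 ^ ((k : ℝ) / 2) * √2 := by
    rw [show ((k + 1 : ℕ) : ℝ) / 2 = (k : ℝ) / 2 + 1 / 2 by push_cast; ring,
      Real.rpow_add (by norm_num), Real.sqrt_eq_rpow]
  have h3 : √((k : ℝ) + 2) = √2 * √((k : ℝ) / 2 + 1) := by
    rw [← Real.sqrt_mul (by norm_num)]
    congr 1
    ring
  have h := Real.Gamma_add_half_le (show 0 < (k : ℝ) / 2 + 1 by positivity)
  have hs2 : 0 < √(2 : ℝ) := by positivity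
  rw [scaleFactor, scaleFactor, h1, h2, ← div_eq_mul_inv, inv_eq_one_div,
    div_le_div_iff₀ (by positivity) (by positivity), h3]
  have : 0 < (2 : ℝ) ^ ((k : ℝ) / 2) * √2 := by positivity
  nlinarith [mul_le_mul_of_nonneg_left h this.le]

/-- Each step down costs √(k - i + 1) ≤ √(2k). Hence the radius 2√(2k) used below: Cauchy's bound
then gains a factor 1/2 for each derivative. -/
theorem scaleFactor_le_mul_pow {k : ℕ} (hk : 1 ≤ k) (i : ℕ) (hi : i ≤ k) :
    scaleFactor (k - i) ≤ scaleFactor k * √(2 * k) ^ i := by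
  induction i with
  | zero => simp
  | succ i ih =>
    have h := scaleFactor_le_succ (k - (i + 1))
    rw [show k - (i + 1) + 1 = k - i by omega] at h
    have hle : √(((k - (i + 1) : ℕ) : ℝ) + 2) ≤ √(2 * k) := by
      refine Real.sqrt_le_sqrt ?_
      have : (k - (i + 1)) + 2 ≤ 2 * k := by omega
      exact_mod_cast this
    calc scaleFactor (k - (i + 1)) ≤ √(((k - (i + 1) : ℕ) : ℝ) + 2) * scaleFactor (k - i) := h
      _ ≤ √(2 * k) * (scaleFactor k * √(2 * k) ^ i) :=
        mul_le_mul hle (ih (by omega)) (scaleFactor_pos _).le (by positivity)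
      _ = _ := by ring

/-- Both sides satisfy the same two-step recursion. They agree at 0, and the moment vanishes at 1.
-/
theorem gaussianMoment_nonneg_and_le : ∀ k : ℕ, 0 ≤ gaussianMoment k ∧ gaussianMoment k ≤ momentScale k
  | 0 => by
    rw [gaussianMoment_zero, momentScale]
    simp
  | 1 => by
    rw [gaussianMoment_one]
    exact ⟨le_rfl, (momentScale_pos 1).le⟩
  | k + 2 => by
    obtain ⟨h1, h2⟩ := gaussianMoment_nonneg_and_le k
    rw [gaussianMoment_add_two]
    refine ⟨by positivity, ?_⟩
    rw [momentScale_eq] at h2 ⊢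
    rw [scaleFactor_eq_mul_add_two] at h2
    rw [Nat.factorial_succ, Nat.factorial_succ]
    push_cast
    calc ((k : ℝ) + 1) * gaussianMoment k ≤ (k + 1) * (k.factorial * ((k + 2) * scaleFactor (k + 2))) :=
          mul_le_mul_of_nonneg_left h2 (by positivity)
      _ = _ := by ring

/-- In the Leibniz formula the term with j derivatives on F is at most M_k S 2^(-j), by Cauchy's
estimate on the circle of radius 2√(2k) and the comparison of T_(k-j) with T_k. The geometric series
sums to at most 2. -/
theorem norm_iteratedDeriv_cexp_mul_le {F : ℂ → ℂ} (hF : Differentiable ℂ F) {k : ℕ} (hk : 1 ≤ k)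
    {S : ℝ} (hS : ∀ s : ℂ, ‖s‖ = 2 * √(2 * k) → ‖F s‖ ≤ S) :
    ‖iteratedDeriv k (fun s => Complex.exp (s ^ 2 / 2) * F s) 0‖ ≤ 2 * momentScale k * S := by
  have hk0 : (0 : ℝ) < k := by exact_mod_cast hk
  have hρ : 0 < √(2 * (k : ℝ)) := by positivity
  have hS0 : 0 ≤ S := (norm_nonneg _).trans (hS ((2 * √(2 * k) : ℝ) : ℂ) (by
    rw [Complex.norm_real, Real.norm_eq_abs, abs_of_pos (by positivity)]))
  have hC : ∀ m : ℕ, ‖iteratedDeriv m F 0‖ ≤ m.factorial * S / (2 * √(2 * k)) ^ m := fun m =>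
    Complex.norm_iteratedDeriv_le_of_forall_mem_sphere_norm_le m (by positivity)
      hF.diffContOnCl (fun s hs => hS s (by simpa using hs))
  rw [iteratedDeriv_fun_mul contDiff_cexp_sq_div_two.contDiffAt hF.contDiff.contDiffAt,
    ← sum_range_reflect]
  calc _ ≤ ∑ j ∈ range (k + 1), momentScale k * S * (1 / 2) ^ j := by
        refine norm_sum_le_of_le _ fun j hj => ?_
        have hj : j ≤ k := Nat.lt_succ_iff.1 (mem_range.1 hj)
        rw [show k + 1 - 1 - j = k - j by omega, Nat.sub_sub_self hj, iteratedDeriv_cexp_sq_div_two,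
          norm_mul, norm_mul, Complex.norm_natCast, Complex.norm_real, Real.norm_eq_abs,
          abs_of_nonneg (gaussianMoment_nonneg_and_le _).1]
        have h1 : gaussianMoment (k - j) ≤
            (k - j).factorial * (scaleFactor k * √(2 * k) ^ j) := by
          refine (gaussianMoment_nonneg_and_le _).2.trans ?_
          rw [momentScale_eq]
          exact mul_le_mul_of_nonneg_left (scaleFactor_le_mul_pow hk j hj) (by positivity)
        have h2 : ((k.choose (k - j) : ℕ) : ℝ) * (k - j).factorial * j.factorial = k.factorial := by
          have := Nat.choose_mul_factorial_mul_factorial (Nat.sub_le k j)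
          rw [Nat.sub_sub_self hj] at this
          exact_mod_cast this
        calc (k.choose (k - j) : ℝ) * gaussianMoment (k - j) * ‖iteratedDeriv j F 0‖
            ≤ (k.choose (k - j) : ℝ) * ((k - j).factorial * (scaleFactor k * √(2 * k) ^ j)) *
              (j.factorial * S / (2 * √(2 * k)) ^ j) := by
              have := (gaussianMoment_nonneg_and_le (k - j)).1
              have := scaleFactor_pos k
              gcongr
              exact hC j
          _ = ((k.choose (k - j) : ℝ) * (k - j).factorial * j.factorial) * scaleFactor k * S *
              (1 / 2) ^ j := by
              rw [mul_pow, div_pow, one_pow]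
              field_simp
          _ = _ := by rw [h2, momentScale_eq]
    _ ≤ 2 * momentScale k * S := by
        rw [← mul_sum]
        have h1 : ∑ j ∈ range (k + 1), (1 / 2 : ℝ) ^ j ≤ 2 := sum_geometric_two_le (k + 1)
        have := mul_le_mul_of_nonneg_left h1 (mul_nonneg (momentScale_pos k).le hS0)
        linarith

theorem iteratedDeriv_eq_zero_of_even {F : ℂ → ℂ} (hF : ∀ s, F (-s) = F s) {k : ℕ} (hk : Odd k) :
    iteratedDeriv k F 0 = 0 := by
  have h := iteratedDeriv_comp_neg k F 0
  rw [funext hF, hk.neg_one_pow, neg_zero] at h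
  simp only [neg_smul, one_smul] at h
  exact self_eq_neg.1 h

theorem iteratedDeriv_cexp_mul_id {k : ℕ} (hk : 1 ≤ k) :
    iteratedDeriv k (fun s : ℂ => Complex.exp (s ^ 2 / 2) * s) 0 =
      ((k * gaussianMoment (k - 1) : ℝ) : ℂ) := by
  obtain ⟨j, rfl⟩ := Nat.exists_eq_add_of_le' hk
  have e : (fun s : ℂ => Complex.exp (s ^ 2 / 2) * s) = fun s => s * Complex.exp (s ^ 2 / 2) := by
    ext s; ring
  rw [e, iteratedDeriv_succ_id_mul (by fun_prop), iteratedDeriv_cexp_sq_div_two]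
  push_cast
  simp

theorem iteratedDeriv_cexp_mul_cube {k : ℕ} (hk : 1 ≤ k) :
    iteratedDeriv k (fun s : ℂ => Complex.exp (s ^ 2 / 2) * s ^ 3) 0 =
      ((k * (k - 1) * gaussianMoment (k - 1) : ℝ) : ℂ) := by
  have e : (fun s : ℂ => Complex.exp (s ^ 2 / 2) * s ^ 3) =
      fun s => s * (s * (s * Complex.exp (s ^ 2 / 2))) := by
    ext s; ring
  rw [e]
  -- For k = 1, 2 both sides vanish, through the factor k - 1 and through μ_1 = 0. Otherwise
  -- k(k-1)(k-2)μ_(k-3) = k(k-1)μ_(k-1).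
  rcases k with _ | _ | _ | j
  · omega
  · rw [iteratedDeriv_succ_id_mul (by fun_prop)]
    simp
  · rw [iteratedDeriv_succ_id_mul (by fun_prop), iteratedDeriv_succ_id_mul (by fun_prop)]
    simp [gaussianMoment_one]
  · rw [iteratedDeriv_succ_id_mul (by fun_prop), iteratedDeriv_succ_id_mul (by fun_prop),
      iteratedDeriv_succ_id_mul (by fun_prop), iteratedDeriv_cexp_sq_div_two,
      show j + 1 + 1 + 1 - 1 = j + 2 by omega, gaussianMoment_add_two]
    push_cast
    ring

/-! ### Second-order expansions -/

/-- The index is the order in X: the products a₁b₂, a₂b₁, a₂b₂ and everything involving a remainder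
have order at least 3, and excess powers of X are bounded by powers of B. -/
theorem norm_mul_sub_second_order_le {a a₁ a₂ b b₁ b₂ : ℂ} {K B X : ℝ} (hK : 0 ≤ K) (hX : 0 ≤ X)
    (hXB : X ≤ B) (ha₁ : ‖a₁‖ ≤ K * X) (hb₁ : ‖b₁‖ ≤ K * X) (ha₂ : ‖a₂‖ ≤ K * X ^ 2)
    (hb₂ : ‖b₂‖ ≤ K * X ^ 2) (ha : ‖a - (1 + a₁ + a₂)‖ ≤ K * X ^ 3)
    (hb : ‖b - (1 + b₁ + b₂)‖ ≤ K * X ^ 3) :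
    ‖a * b - (1 + (a₁ + b₁) + (a₂ + a₁ * b₁ + b₂))‖ ≤
      (2 * K ^ 2 + K ^ 2 * B + 2 * K * (1 + K * B + K * B ^ 2 + K * B ^ 3)) * X ^ 3 := by
  have hB : 0 ≤ B := hX.trans hXB
  have e : a * b - (1 + (a₁ + b₁) + (a₂ + a₁ * b₁ + b₂)) =
      a₁ * b₂ + a₂ * b₁ + a₂ * b₂ +
      (a - (1 + a₁ + a₂)) * (1 + b₁ + b₂ + (b - (1 + b₁ + b₂))) +
      (1 + a₁ + a₂) * (b - (1 + b₁ + b₂)) := by ring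
  have h1 : ‖a₁ * b₂‖ ≤ K ^ 2 * X ^ 3 := by
    rw [norm_mul]
    calc _ ≤ K * X * (K * X ^ 2) := by gcongr
      _ = _ := by ring
  have h2 : ‖a₂ * b₁‖ ≤ K ^ 2 * X ^ 3 := by
    rw [norm_mul]
    calc _ ≤ K * X ^ 2 * (K * X) := by gcongr
      _ = _ := by ring
  have h3 : ‖a₂ * b₂‖ ≤ K ^ 2 * B * X ^ 3 := by
    rw [norm_mul]
    calc _ ≤ K * X ^ 2 * (K * X ^ 2) := by gcongr
      _ = K ^ 2 * X * X ^ 3 := by ring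
      _ ≤ _ := by gcongr
  have h4 : ∀ {c₁ c₂ c₃ : ℂ}, ‖c₁‖ ≤ K * X → ‖c₂‖ ≤ K * X ^ 2 → ‖c₃‖ ≤ K * X ^ 3 →
      ‖1 + c₁ + c₂ + c₃‖ ≤ 1 + K * B + K * B ^ 2 + K * B ^ 3 := by
    intro c₁ c₂ c₃ h₁ h₂ h₃
    refine (norm_add_le _ _).trans (add_le_add ((norm_add_le _ _).trans
      (add_le_add ((norm_add_le _ _).trans (add_le_add norm_one.le (h₁.trans ?_))) (h₂.trans ?_)))
      (h₃.trans ?_)) <;> gcongr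
  have h5 := h4 hb₁ hb₂ hb
  have h6 := h4 ha₁ ha₂ (c₃ := 0) (by rw [norm_zero]; positivity)
  rw [add_zero] at h6
  rw [e]
  calc _ ≤ K ^ 2 * X ^ 3 + K ^ 2 * X ^ 3 + K ^ 2 * B * X ^ 3 +
        K * X ^ 3 * (1 + K * B + K * B ^ 2 + K * B ^ 3) +
        (1 + K * B + K * B ^ 2 + K * B ^ 3) * (K * X ^ 3) := by
        refine norm_add_le_of_le (norm_add_le_of_le (norm_add_le_of_le
          (norm_add_le_of_le h1 h2) h3) ?_) ?_
        · rw [norm_mul]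
          gcongr
        · rw [norm_mul]
          gcongr
    _ = _ := by ring

/-- With X = L|u|³, the condition |u| ≤ X makes Lu⁴ of order X² and L|u|⁵ of order X³. So the
exponent f is Lu³/6 + Lu⁴/24 up to order X³, and e^f needs only its quadratic Taylor polynomial. -/
theorem norm_cexp_mul_sub_second_order_le {L B : ℝ} {u : ℂ} (hL : 0 ≤ L) (hu : ‖u‖ ≤ 1)
    (huX : ‖u‖ ≤ L * ‖u‖ ^ 3) (hB : L * ‖u‖ ^ 3 ≤ B) :
    ‖Complex.exp (L * (Complex.exp u - 1 - u - u ^ 2 / 2)) -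
      (1 + L * u ^ 3 / 6 + (L * u ^ 4 / 24 + (L * u ^ 3 / 6) ^ 2 / 2))‖ ≤
      (125 * Real.exp (5 * B) + 15) * (L * ‖u‖ ^ 3) ^ 3 := by
  set y := ‖u‖ with hy
  set X := L * y ^ 3 with hX
  have hy0 : 0 ≤ y := norm_nonneg u
  have hX0 : 0 ≤ X := by positivity
  set f : ℂ := L * (Complex.exp u - 1 - u - u ^ 2 / 2) with hf
  have hLn : ‖(L : ℂ)‖ = L := by rw [Complex.norm_real, Real.norm_eq_abs, abs_of_nonneg hL]
  have h3 : ‖f - L * u ^ 3 / 6 - L * u ^ 4 / 24‖ ≤ 3 * (X * y ^ 2) := by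
    have e : f - L * u ^ 3 / 6 - L * u ^ 4 / 24 =
        L * (Complex.exp u - ∑ m ∈ range 5, u ^ m / (m.factorial : ℂ)) := by
      simp [sum_range_succ, Nat.factorial, hf]
      ring
    have h := Complex.norm_exp_sub_sum_le_norm_mul_exp u 5
    have he : Real.exp ‖u‖ ≤ 3 := (Real.exp_le_exp.2 hu).trans (by linarith [Real.exp_one_lt_d9])
    rw [e, norm_mul, hLn]
    calc _ ≤ L * (y ^ 5 * 3) := by
          refine mul_le_mul_of_nonneg_left (h.trans ?_) hL
          gcongr
      _ = _ := by rw [hX]; ring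
  have h1 : ‖(L : ℂ) * u ^ 3 / 6‖ ≤ X := by
    rw [norm_div, norm_mul, norm_pow, hLn]
    norm_num
    rw [← hy, ← hX]
    linarith
  have h2 : ‖(L : ℂ) * u ^ 4 / 24‖ ≤ X * y := by
    rw [norm_div, norm_mul, norm_pow, hLn]
    norm_num
    rw [← hy]
    have : L * y ^ 4 = X * y := by rw [hX]; ring
    rw [this]
    have : 0 ≤ X * y := by positivity
    linarith
  have hXy2 : X * y ^ 2 ≤ X * y := by
    refine mul_le_mul_of_nonneg_left ?_ hX0
    nlinarith
  have hXy : X * y ≤ X ^ 2 := by rw [sq]; exact mul_le_mul_of_nonneg_left huX hX0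
  have hXy' : X * y ≤ X := mul_le_of_le_one_right hX0 hu
  have hXy3 : X * y ^ 2 ≤ X ^ 3 := by
    calc X * y ^ 2 ≤ X * X ^ 2 := by gcongr
      _ = X ^ 3 := by ring
  have hd : ‖f - L * u ^ 3 / 6‖ ≤ 4 * X * y := by
    have e : f - L * u ^ 3 / 6 = (f - L * u ^ 3 / 6 - L * u ^ 4 / 24) + L * u ^ 4 / 24 := by ring
    rw [e]
    refine (norm_add_le_of_le h3 h2).trans ?_
    linarith
  have hfn : ‖f‖ ≤ 5 * X := by
    have e : f = (f - L * u ^ 3 / 6) + L * u ^ 3 / 6 := by ring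
    rw [e]
    refine (norm_add_le_of_le hd h1).trans ?_
    linarith
  have hexp := Complex.norm_exp_sub_sum_le_norm_mul_exp f 3
  -- Three errors: the tail of e^f, giving 5³ e^(5B) from |f| ≤ 5X; the tail of f, giving 3; and
  -- half the difference of the squares of f and Lu³/6, giving 12.
  have e : Complex.exp f - (1 + L * u ^ 3 / 6 + (L * u ^ 4 / 24 + (L * u ^ 3 / 6) ^ 2 / 2)) =
      (Complex.exp f - ∑ m ∈ range 3, f ^ m / (m.factorial : ℂ)) +
      (f - L * u ^ 3 / 6 - L * u ^ 4 / 24) +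
      (f - L * u ^ 3 / 6) * (f + L * u ^ 3 / 6) / 2 := by
    simp [sum_range_succ, Nat.factorial]
    ring
  rw [e]
  calc _ ≤ (5 * X) ^ 3 * Real.exp (5 * B) + 3 * X ^ 3 + 12 * X ^ 3 := by
        refine norm_add_le_of_le (norm_add_le_of_le (hexp.trans ?_) (h3.trans (by linarith))) ?_
        · gcongr
          linarith
        · rw [norm_div, norm_mul]
          norm_num
          have h7 : ‖f + L * u ^ 3 / 6‖ ≤ 6 * X := (norm_add_le_of_le hfn h1).trans (by linarith)
          have h8 : ‖f - L * u ^ 3 / 6‖ * ‖f + L * u ^ 3 / 6‖ ≤ 4 * X ^ 2 * (6 * X) :=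
            mul_le_mul (hd.trans (by linarith)) h7 (norm_nonneg _) (by positivity)
          nlinarith
    _ = _ := by ring

/-- Cauchy's estimates make the Taylor tail a geometric series of ratio |u|/r ≤ 1/2. -/
theorem norm_sub_taylor_two_le {R : ℂ → ℂ} (hR : Differentiable ℂ R) {K r : ℝ} (hr : 0 < r)
    (hK : ∀ u, ‖u‖ = r → ‖R u‖ ≤ K) {u : ℂ} (hu : ‖u‖ ≤ r / 2) :
    ‖R u - (R 0 + deriv R 0 * u + iteratedDeriv 2 R 0 / 2 * u ^ 2)‖ ≤ 2 * K * (‖u‖ / r) ^ 3 := by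
  have hK0 : 0 ≤ K := (norm_nonneg _).trans (hK (r : ℂ) (by
    rw [Complex.norm_real, Real.norm_eq_abs, abs_of_pos hr]))
  have hs := Complex.hasSum_taylorSeries_of_entire hR 0 u
  rw [← hasSum_nat_add_iff' 3] at hs
  have hC : ∀ m : ℕ, ‖iteratedDeriv m R 0‖ ≤ m.factorial * K / r ^ m := fun m =>
    Complex.norm_iteratedDeriv_le_of_forall_mem_sphere_norm_le m hr
      hR.diffContOnCl (fun s hs => hK s (by simpa using hs))
  have hq : ‖u‖ / r ≤ 1 / 2 := by rw [div_le_iff₀ hr]; linarith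
  have hq0 : 0 ≤ ‖u‖ / r := by positivity
  have hterm : ∀ n : ℕ, ‖(((n + 3).factorial : ℂ))⁻¹ • (u - 0) ^ (n + 3) • iteratedDeriv (n + 3) R 0‖ ≤
      K * (‖u‖ / r) ^ 3 * (1 / 2) ^ n := by
    intro n
    rw [smul_eq_mul, smul_eq_mul, norm_mul, norm_mul, norm_inv, Complex.norm_natCast, norm_pow,
      sub_zero]
    have hf : (0 : ℝ) < (n + 3).factorial := by positivity
    calc (((n + 3).factorial : ℝ))⁻¹ * (‖u‖ ^ (n + 3) * ‖iteratedDeriv (n + 3) R 0‖)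
        ≤ (((n + 3).factorial : ℝ))⁻¹ * (‖u‖ ^ (n + 3) * ((n + 3).factorial * K / r ^ (n + 3))) := by
          gcongr
          exact hC _
      _ = K * (‖u‖ / r) ^ 3 * (‖u‖ / r) ^ n := by
          rw [mul_assoc K, ← pow_add, div_pow, add_comm 3 n]
          field_simp
      _ ≤ _ := by gcongr
  have hgeom := (hasSum_geometric_two).mul_left (K * (‖u‖ / r) ^ 3)
  have h := hs.norm_le_of_bounded hgeom hterm
  have e : R u - ∑ i ∈ range 3, ((i.factorial : ℂ))⁻¹ • (u - 0) ^ i • iteratedDeriv i R 0 =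
      R u - (R 0 + deriv R 0 * u + iteratedDeriv 2 R 0 / 2 * u ^ 2) := by
    simp [sum_range_succ, iteratedDeriv_one]
    ring
  rw [e] at h
  linarith

/-! ### The normalized generating function -/

/-- The mean over `n ≤ x` of `exp (u (ω(n) - T))`, divided by `exp (L (exp u - 1))`,
where `L = log log x`. -/
noncomputable def normalizedGenFun (x T : ℝ) (u : ℂ) : ℂ :=
  (∑ n ∈ Icc 1 ⌊x⌋₊, Complex.exp (u * ((ArithmeticFunction.cardDistinctFactors n : ℂ) - T))) /
    (⌊x⌋₊ : ℂ) * Complex.exp (-(Real.log (Real.log x) * (Complex.exp u - 1)))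

theorem differentiable_normalizedGenFun (x T : ℝ) : Differentiable ℂ (normalizedGenFun x T) := by
  unfold normalizedGenFun
  fun_prop

theorem normalizedGenFun_zero {x : ℝ} (hx : 3 ≤ x) (T : ℝ) : normalizedGenFun x T 0 = 1 := by
  have hN : (⌊x⌋₊ : ℂ) ≠ 0 := by
    have : 3 ≤ ⌊x⌋₊ := Nat.le_floor (by exact_mod_cast hx)
    exact_mod_cast (by omega : ⌊x⌋₊ ≠ 0)
  simp [normalizedGenFun, hN]

theorem deriv_normalizedGenFun_zero {x : ℝ} (hx : 3 ≤ x) (T : ℝ) :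
    deriv (normalizedGenFun x T) 0 =
      (((∑ n ∈ Icc 1 ⌊x⌋₊, (ArithmeticFunction.cardDistinctFactors n : ℝ)) / ⌊x⌋₊ -
        Real.log (Real.log x) - T : ℝ) : ℂ) := by
  have hN : (⌊x⌋₊ : ℂ) ≠ 0 := by
    have : 3 ≤ ⌊x⌋₊ := Nat.le_floor (by exact_mod_cast hx)
    exact_mod_cast (by omega : ⌊x⌋₊ ≠ 0)
  have h1 : HasDerivAt (fun u : ℂ => (∑ n ∈ Icc 1 ⌊x⌋₊,
      Complex.exp (u * ((ArithmeticFunction.cardDistinctFactors n : ℂ) - T))) / (⌊x⌋₊ : ℂ))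
      ((∑ n ∈ Icc 1 ⌊x⌋₊, ((ArithmeticFunction.cardDistinctFactors n : ℂ) - T)) / (⌊x⌋₊ : ℂ)) 0 := by
    refine HasDerivAt.div_const (HasDerivAt.fun_sum fun n _ => ?_) _
    have := ((hasDerivAt_id (0 : ℂ)).mul_const
      ((ArithmeticFunction.cardDistinctFactors n : ℂ) - T)).cexp
    simpa using this
  have h2 : HasDerivAt (fun u : ℂ => Complex.exp (-(Real.log (Real.log x) * (Complex.exp u - 1))))
      (-Real.log (Real.log x)) 0 := by
    have := ((((Complex.hasDerivAt_exp 0).sub_const 1).const_mul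
      ((Real.log (Real.log x) : ℝ) : ℂ)).fun_neg).cexp
    simpa using this
  refine (h1.fun_mul h2).deriv.trans ?_
  simp [sum_sub_distrib]
  field_simp
  ring

/-- With w = e^u - 1, the divisor exp(Lw) has modulus exactly (log x)^(Re w), the size of the bound
for mean((1+w)^ω). The radius 1/8 ensures |w| ≤ 2|u| ≤ 1/4. -/
theorem exists_norm_normalizedGenFun_le (A : ℝ) :
    ∃ K : ℝ, 0 < K ∧ ∀ (x T : ℝ) (u : ℂ), 3 ≤ x → |T| ≤ A → ‖u‖ ≤ 1 / 8 →
      ‖normalizedGenFun x T u‖ ≤ K := by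
  obtain ⟨K, hK, h⟩ := exists_norm_mean_one_add_pow_le
  refine ⟨K * Real.exp A, by positivity, fun x T u hx hT hu => ?_⟩
  set w := Complex.exp u - 1 with hw
  have hwn : ‖w‖ ≤ 1 / 4 := (Complex.norm_exp_sub_one_le (by linarith)).trans (by linarith)
  have hmean := h w x hwn hx
  have hlogx : 0 < Real.log x := Real.log_pos (by linarith)
  have e : normalizedGenFun x T u = (∑ n ∈ Icc 1 ⌊x⌋₊,
      (1 + w) ^ ArithmeticFunction.cardDistinctFactors n) / (⌊x⌋₊ : ℂ) *
      Complex.exp (-(u * T)) * Complex.exp (-(Real.log (Real.log x) * w)) := by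
    rw [normalizedGenFun, hw, div_mul_eq_mul_div _ _ (Complex.exp (-(u * T))), sum_mul]
    congr 2
    refine sum_congr rfl fun n _ => ?_
    rw [add_sub_cancel, ← Complex.exp_nat_mul, ← Complex.exp_add]
    congr 1
    ring
  have h1 : ‖Complex.exp (-(u * T))‖ ≤ Real.exp A := by
    refine (Complex.norm_exp_le_exp_norm _).trans (Real.exp_le_exp.2 ?_)
    rw [norm_neg, norm_mul, Complex.norm_real, Real.norm_eq_abs]
    calc ‖u‖ * |T| ≤ 1 * A := mul_le_mul (by linarith) hT (abs_nonneg _) (by norm_num)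
      _ = A := one_mul A
  have h2 : ‖Complex.exp (-(Real.log (Real.log x) * w))‖ = (Real.log x ^ w.re)⁻¹ := by
    rw [Complex.norm_exp, Complex.neg_re, Complex.re_ofReal_mul, Real.rpow_def_of_pos hlogx,
      Real.exp_neg]
  have h3 : 0 < Real.log x ^ w.re := by positivity
  rw [e, norm_mul, norm_mul, h2]
  calc _ ≤ K * Real.log x ^ w.re * Real.exp A * (Real.log x ^ w.re)⁻¹ := by gcongr
    _ = K * Real.exp A := by field_simp

/-- The Taylor polynomial of degree two of `normalizedGenFun x T` has bounded coefficients and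
approximates it well, uniformly in `x` and `T`. -/
theorem exists_normalizedGenFun_expansion (A : ℝ) :
    ∃ K : ℝ, 0 < K ∧ ∀ x T : ℝ, 3 ≤ x → |T| ≤ A → ∃ r₂ : ℂ,
      ‖deriv (normalizedGenFun x T) 0‖ ≤ K ∧ ‖r₂‖ ≤ K ∧ ∀ u : ℂ, ‖u‖ ≤ 1 / 16 →
        ‖normalizedGenFun x T u - (1 + deriv (normalizedGenFun x T) 0 * u + r₂ * u ^ 2)‖ ≤
          K * ‖u‖ ^ 3 := by
  obtain ⟨K, hK, h⟩ := exists_norm_normalizedGenFun_le A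
  -- Cauchy's estimates on |u| = 1/8 give 8K and 64K for the coefficients and 2·8³K for the
  -- remainder.
  refine ⟨1024 * K, by positivity, fun x T hx hT =>
    ⟨iteratedDeriv 2 (normalizedGenFun x T) 0 / 2, ?_, ?_, fun u hu => ?_⟩⟩
  · have := Complex.norm_iteratedDeriv_le_of_forall_mem_sphere_norm_le (c := 0) (R := 1 / 8) (C := K) 1 (by norm_num)
      (differentiable_normalizedGenFun x T).diffContOnCl
      (fun u hu => h x T u hx hT (by simpa using (mem_sphere_zero_iff_norm.1 hu).le))
    rw [iteratedDeriv_one] at this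
    refine this.trans ?_
    norm_num
    linarith
  · have := Complex.norm_iteratedDeriv_le_of_forall_mem_sphere_norm_le (c := 0) (R := 1 / 8) (C := K) 2 (by norm_num)
      (differentiable_normalizedGenFun x T).diffContOnCl
      (fun u hu => h x T u hx hT (by simpa using (mem_sphere_zero_iff_norm.1 hu).le))
    rw [norm_div]
    norm_num at this ⊢
    linarith
  · have := norm_sub_taylor_two_le (differentiable_normalizedGenFun x T) (r := 1 / 8) (by norm_num)
      (fun u hu => h x T u hx hT hu.le) (u := u) (by linarith)
    rw [normalizedGenFun_zero hx] at this
    refine this.trans (le_of_eq ?_)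
    ring

/-! ### Expansion on the circle |s| = 2√(2k) -/

theorem iteratedDeriv_cexp_mul_const (k : ℕ) (c : ℂ) :
    iteratedDeriv k (fun s : ℂ => Complex.exp (s * c)) 0 = c ^ k := by
  have := congrFun (iteratedDeriv_cexp_const_mul k c) 0
  simp_all [mul_comm]

theorem iteratedDeriv_mean_cexp (k N : ℕ) (X : ℕ → ℝ) :
    iteratedDeriv k (fun s : ℂ => (∑ n ∈ Icc 1 N, Complex.exp (s * X n)) / (N : ℂ)) 0 =
      (((∑ n ∈ Icc 1 N, X n ^ k) / N : ℝ) : ℂ) := by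
  simp only [div_eq_mul_inv]
  rw [iteratedDeriv_mul_const_field, iteratedDeriv_fun_sum fun n _ => by fun_prop]
  simp [iteratedDeriv_cexp_mul_const]

/-- The quadratic correction to the generating function of the normalized moments. -/
noncomputable def secondOrderTerm (ε : ℝ) (r₁ r₂ s : ℂ) : ℂ :=
  ε ^ 2 * (s ^ 6 / 72 + s ^ 4 / 24 + r₁ * s ^ 4 / 6 + r₂ * s ^ 2)

/-- Here y = |u| satisfies Ly² = 8k, so Ly³ = 8ky ≥ y and (Ly³)² = 512k³/L ≤ (23τ)². The bound y ≤
1/16 amounts to k ≤ L/2048, which the lower bound on L guarantees given k³ ≤ A³L. -/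
theorem scaled_radius_bounds {A L ε τ y : ℝ} {k : ℕ} (hA : 0 < A) (hk : 1 ≤ k)
    (hL₀ : 2048 ^ 2 * (A + 1) ^ 2 ≤ L) (hkA : (k : ℝ) ^ 3 ≤ A ^ 3 * L) (hε : 0 < ε)
    (hLε : L * ε ^ 2 = 1) (hτ : 0 ≤ τ) (hτ2 : τ ^ 2 = k ^ 3 / L) (hy : y = ε * (2 * √(2 * k))) :
    y ≤ 1 / 16 ∧ y ≤ L * y ^ 3 ∧ L * y ^ 3 ≤ 23 * τ ∧ τ ≤ √(A ^ 3) := by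
  have hk1 : (1 : ℝ) ≤ k := by exact_mod_cast hk
  have hL0 : 0 < L := lt_of_lt_of_le (by positivity) hL₀
  have hy0 : 0 ≤ y := by rw [hy]; positivity
  have hy2 : L * y ^ 2 = 8 * k := by
    have h1 := Real.sq_sqrt (show (0 : ℝ) ≤ 2 * k by positivity)
    rw [hy]
    calc L * (ε * (2 * √(2 * k))) ^ 2 = (L * ε ^ 2) * (4 * √(2 * k) ^ 2) := by ring
      _ = _ := by rw [hLε, h1]; ring
  have hXk : L * y ^ 3 = 8 * k * y := by rw [← hy2]; ring
  refine ⟨?_, ?_, ?_, ?_⟩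
  · have hkL : (k : ℝ) ≤ L / 2048 := by
      refine le_of_pow_le_pow_left₀ (n := 3) (by norm_num) (by positivity) (hkA.trans ?_)
      have h1 : 2048 ^ 4 * (A + 1) ^ 4 ≤ L ^ 2 := by
        calc 2048 ^ 4 * (A + 1) ^ 4 = (2048 ^ 2 * (A + 1) ^ 2) ^ 2 := by ring
          _ ≤ L ^ 2 := by gcongr
      have h2 : A ^ 3 ≤ (A + 1) ^ 4 := by
        calc A ^ 3 ≤ (A + 1) ^ 3 := by gcongr; linarith
          _ ≤ (A + 1) ^ 4 := pow_le_pow_right₀ (by linarith) (by norm_num)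
      have h3 : A ^ 3 ≤ L ^ 2 / 2048 ^ 3 := by
        rw [le_div_iff₀ (by norm_num)]
        have : 0 ≤ (A + 1) ^ 4 := by positivity
        linarith
      calc A ^ 3 * L ≤ L ^ 2 / 2048 ^ 3 * L := by gcongr
        _ = _ := by ring
    refine le_of_sq_le_sq ?_ (by norm_num)
    have : L * y ^ 2 ≤ L * (1 / 16) ^ 2 := by rw [hy2]; linarith
    exact le_of_mul_le_mul_left this hL0
  · rw [hXk]
    nlinarith
  · refine le_of_sq_le_sq ?_ (by positivity)
    have hX2 : (L * y ^ 3) ^ 2 = 512 * τ ^ 2 := by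
      rw [hτ2, hXk, mul_pow, eq_comm]
      have : y ^ 2 = 8 * k / L := by rw [← hy2]; field_simp
      rw [this]
      ring
    rw [hX2, mul_pow]
    nlinarith [sq_nonneg τ]
  · refine Real.le_sqrt_of_sq_le ?_
    rw [hτ2, div_le_iff₀ hL0]
    exact hkA

/-- Multiply the second-order expansions of exp(L(e^u - 1 - u - u²/2)) and R(u) in powers of X =
L|u|³ ≤ 23τ. The relation Lε² = 1 rewrites the terms of orders one and two in s and ε. -/
theorem exists_generatingFunction_expansion (A : ℝ) (hA : 0 < A) :
    ∃ C L₀ : ℝ, 0 < C ∧ 0 < L₀ ∧ ∀ (x T L ε τ : ℝ) (k : ℕ), L = Real.log (Real.log x) → 3 ≤ x →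
      1 ≤ k → |T| ≤ A → L₀ ≤ L → (k : ℝ) ^ 3 ≤ A ^ 3 * L → 0 < ε → L * ε ^ 2 = 1 → 0 ≤ τ →
      τ ^ 2 = k ^ 3 / L → ∃ r₂ : ℂ, ∀ s : ℂ, ‖s‖ = 2 * √(2 * k) →
        ‖secondOrderTerm ε (deriv (normalizedGenFun x T) 0) r₂ s‖ ≤ C * τ ^ 2 ∧
        ‖Complex.exp (L * (Complex.exp (ε * s) - 1 - ε * s - (ε * s) ^ 2 / 2)) *
          normalizedGenFun x T (ε * s) - (1 + ε * (s ^ 3 / 6 + deriv (normalizedGenFun x T) 0 * s) +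
            secondOrderTerm ε (deriv (normalizedGenFun x T) 0) r₂ s)‖ ≤ C * τ ^ 3 := by
  obtain ⟨K₁, hK₁, hR⟩ := exists_normalizedGenFun_expansion A
  set B : ℝ := 23 * √(A ^ 3) with hB
  have hB0 : 0 ≤ B := by positivity
  set K : ℝ := 125 * Real.exp (5 * B) + 15 + K₁ with hK
  have hK1 : 1 ≤ K := by
    have := Real.exp_pos (5 * B)
    linarith
  have hKK₁ : K₁ ≤ K := by
    have := Real.exp_pos (5 * B)
    linarith
  have hK0 : 0 < K := by linarith
  set C₂ : ℝ := 2 * K + K ^ 2 with hC₂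
  set C₃ : ℝ := 2 * K ^ 2 + K ^ 2 * B + 2 * K * (1 + K * B + K * B ^ 2 + K * B ^ 3) with hC₃
  refine ⟨C₂ * 23 ^ 2 + C₃ * 23 ^ 3, 2048 ^ 2 * (A + 1) ^ 2, by positivity, by positivity,
    fun x T L ε τ k hL hx hk hT hL₀ hkA hε hLε hτ hτ2 => ?_⟩
  obtain ⟨r₂, hr₁, hr₂, hexp⟩ := hR x T hx hT
  refine ⟨r₂, fun s hs => ?_⟩
  set r₁ := deriv (normalizedGenFun x T) 0 with hr₁def
  set u : ℂ := ε * s with hu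
  have hL0 : 0 < L := lt_of_lt_of_le (by positivity) hL₀
  have hun : ‖u‖ = ε * (2 * √(2 * k)) := by
    rw [hu, norm_mul, hs, Complex.norm_real, Real.norm_eq_abs, abs_of_pos hε]
  obtain ⟨hu16, huX, hXτ, hτA⟩ := scaled_radius_bounds hA hk hL₀ hkA hε hLε hτ hτ2 hun
  set X := L * ‖u‖ ^ 3 with hX
  have hX0 : 0 ≤ X := by positivity
  have hXB : X ≤ B := hXτ.trans (by rw [hB]; linarith)
  have hu1 : ‖u‖ ≤ 1 := by linarith
  have hy0 := norm_nonneg u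
  have hLn : ‖(L : ℂ)‖ = L := by rw [Complex.norm_real, Real.norm_eq_abs, abs_of_pos hL0]
  have ha₁ : ‖(L : ℂ) * u ^ 3 / 6‖ ≤ X := by
    rw [norm_div, norm_mul, norm_pow, hLn]
    norm_num
    rw [← hX]
    linarith
  have ha₂ : ‖(L : ℂ) * u ^ 4 / 24 + (L * u ^ 3 / 6) ^ 2 / 2‖ ≤ X ^ 2 := by
    have h1 : ‖(L : ℂ) * u ^ 4 / 24‖ ≤ X ^ 2 / 2 := by
      rw [norm_div, norm_mul, norm_pow, hLn]
      norm_num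
      have : L * ‖u‖ ^ 4 = X * ‖u‖ := by rw [hX]; ring
      rw [this]
      nlinarith [mul_le_mul_of_nonneg_left huX hX0]
    have h2 : ‖((L : ℂ) * u ^ 3 / 6) ^ 2 / 2‖ ≤ X ^ 2 / 2 := by
      rw [norm_div, norm_pow]
      norm_num
      gcongr
      simpa using ha₁
    refine (norm_add_le_of_le h1 h2).trans (by linarith)
  have hb₁ : ‖r₁ * u‖ ≤ K * X := by
    rw [norm_mul]
    exact mul_le_mul (hr₁.trans hKK₁) huX hy0 hK0.le
  have hb₂ : ‖r₂ * u ^ 2‖ ≤ K * X ^ 2 := by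
    rw [norm_mul, norm_pow]
    exact mul_le_mul (hr₂.trans hKK₁) (by gcongr) (by positivity) hK0.le
  have hb₃ : ‖normalizedGenFun x T u - (1 + r₁ * u + r₂ * u ^ 2)‖ ≤ K * X ^ 3 :=
    (hexp u hu16).trans (mul_le_mul hKK₁ (by gcongr) (by positivity) hK0.le)
  have ha₃ := norm_cexp_mul_sub_second_order_le hL0.le hu1 huX hXB
  rw [← hX] at ha₃
  have hKX : X ≤ K * X := le_mul_of_one_le_left hX0 hK1
  have hKX2 : X ^ 2 ≤ K * X ^ 2 := le_mul_of_one_le_left (by positivity) hK1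
  have hprod := norm_mul_sub_second_order_le hK0.le hX0 hXB (ha₁.trans hKX) hb₁ (ha₂.trans hKX2) hb₂
    (ha₃.trans (mul_le_mul_of_nonneg_right (by rw [hK]; linarith) (by positivity))) hb₃
  have hLεc : (L : ℂ) * (ε : ℂ) ^ 2 = 1 := by exact_mod_cast hLε
  have e₁ : (L : ℂ) * u ^ 3 / 6 + r₁ * u = ε * (s ^ 3 / 6 + r₁ * s) := by
    rw [hu]
    linear_combination (ε * s ^ 3 / 6 : ℂ) * hLεc
  have e₂ : (L : ℂ) * u ^ 4 / 24 + (L * u ^ 3 / 6) ^ 2 / 2 + L * u ^ 3 / 6 * (r₁ * u) + r₂ * u ^ 2 =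
      secondOrderTerm ε r₁ r₂ s := by
    rw [hu, secondOrderTerm]
    linear_combination (ε ^ 2 * s ^ 4 / 24 + ε ^ 2 * s ^ 4 * r₁ / 6 +
      ε ^ 2 * s ^ 6 / 72 * (L * ε ^ 2 + 1) : ℂ) * hLεc
  rw [e₁, e₂] at hprod
  have hC₂0 : 0 ≤ C₂ := by positivity
  have hC₃0 : 0 ≤ C₃ := by positivity
  constructor
  · rw [← e₂]
    calc _ ≤ K * X ^ 2 + K * X * (K * X) + K * X ^ 2 := by
          refine norm_add_le_of_le (norm_add_le_of_le (ha₂.trans hKX2) ?_) hb₂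
          rw [norm_mul]
          exact mul_le_mul (ha₁.trans hKX) hb₁ (norm_nonneg _) (by positivity)
      _ = C₂ * X ^ 2 := by rw [hC₂]; ring
      _ ≤ C₂ * (23 * τ) ^ 2 := by gcongr
      _ ≤ _ := by
        have : 0 ≤ C₃ * 23 ^ 3 * τ ^ 2 := by positivity
        linarith
  · calc _ ≤ C₃ * X ^ 3 := hprod
      _ ≤ C₃ * (23 * τ) ^ 3 := by gcongr
      _ ≤ _ := by
        have : 0 ≤ C₂ * 23 ^ 2 * τ ^ 3 := by positivity
        linarith

/-- Since s²/2 = L(εs)²/2, the exponential factors cancel the Poisson normalization except for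
e^(-Lεs), which centres ω at L. -/
theorem cexp_mul_normalizedGenFun_eq {x T L ε : ℝ} (hL : L = Real.log (Real.log x))
    (hLε : L * ε ^ 2 = 1) (s : ℂ) :
    Complex.exp (s ^ 2 / 2) *
      (Complex.exp (L * (Complex.exp (ε * s) - 1 - ε * s - (ε * s) ^ 2 / 2)) *
        normalizedGenFun x T (ε * s)) =
      (∑ n ∈ Icc 1 ⌊x⌋₊, Complex.exp (s *
        ((((ArithmeticFunction.cardDistinctFactors n : ℝ) - L - T) * ε : ℝ) : ℂ))) / (⌊x⌋₊ : ℂ) := by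
  have hLεc : (L : ℂ) * (ε : ℂ) ^ 2 = 1 := by exact_mod_cast hLε
  rw [normalizedGenFun, ← hL, ← mul_assoc, ← Complex.exp_add, mul_comm, mul_assoc,
    ← Complex.exp_add, div_mul_eq_mul_div, sum_mul]
  congr 1
  refine sum_congr rfl fun n _ => ?_
  rw [← Complex.exp_add]
  congr 1
  push_cast
  linear_combination (-s ^ 2 / 2) * hLεc

theorem iteratedDeriv_add_of_differentiable {f g : ℂ → ℂ} (hf : Differentiable ℂ f)
    (hg : Differentiable ℂ g) (k : ℕ) :
    iteratedDeriv k (fun s => f s + g s) 0 = iteratedDeriv k f 0 + iteratedDeriv k g 0 :=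
  iteratedDeriv_fun_add hf.contDiff.contDiffAt hg.contDiff.contDiffAt

/-! ### The moments for large L -/

/-- The linear coefficient is kept as the exact mean of ω minus L + T; its replacement by a - T is
left to the end. -/
theorem exists_abs_moment_sub_le_of_large (A : ℝ) (hA : 0 < A) :
    ∃ C L₀ : ℝ, 0 < C ∧ 0 < L₀ ∧ ∀ (x T L ε τ : ℝ) (k : ℕ), L = Real.log (Real.log x) → 3 ≤ x →
      1 ≤ k → |T| ≤ A → L₀ ≤ L → (k : ℝ) ^ 3 ≤ A ^ 3 * L → 0 < ε → L * ε ^ 2 = 1 → 0 ≤ τ →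
      τ ^ 2 = k ^ 3 / L →
      |meanUpTo x (fun n =>
          (((ArithmeticFunction.cardDistinctFactors n : ℝ) - L - T) * ε) ^ k) -
        (gaussianMoment k + ((k : ℝ) * (k - 1) / 6 + k *
          ((∑ n ∈ Icc 1 ⌊x⌋₊, (ArithmeticFunction.cardDistinctFactors n : ℝ)) / ⌊x⌋₊ - L - T)) *
            (gaussianMoment (k - 1) * ε))| ≤ C * (momentScale k * τ ^ (if Odd k then 3 else 2)) := by
  obtain ⟨C, L₀, hC, hL₀, hexp⟩ := exists_generatingFunction_expansion A hA
  refine ⟨2 * C * (1 + √(A ^ 3)), L₀, by positivity, hL₀,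
    fun x T L ε τ k hL hx hk hT hLL₀ hkA hε hLε hτ hτ2 => ?_⟩
  obtain ⟨r₂, hr⟩ := hexp x T L ε τ k hL hx hk hT hLL₀ hkA hε hLε hτ hτ2
  have hL0 : 0 < L := by linarith
  set r : ℝ := (∑ n ∈ Icc 1 ⌊x⌋₊, (ArithmeticFunction.cardDistinctFactors n : ℝ)) / ⌊x⌋₊ - L - T with hrdef
  have hr₁ : deriv (normalizedGenFun x T) 0 = (r : ℂ) := by
    rw [deriv_normalizedGenFun_zero hx, ← hL]
  rw [hr₁] at hr
  set h : ℂ → ℂ := fun s => Complex.exp (L * (Complex.exp (ε * s) - 1 - ε * s - (ε * s) ^ 2 / 2)) *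
    normalizedGenFun x T (ε * s) with hh
  have hhd : Differentiable ℂ h := by
    have h1 : Differentiable ℂ fun s : ℂ => normalizedGenFun x T (ε * s) :=
      (differentiable_normalizedGenFun x T).comp (by fun_prop)
    exact Differentiable.fun_mul (by fun_prop) h1
  set P : ℂ → ℂ := secondOrderTerm ε r r₂ with hP
  have hPd : Differentiable ℂ P := by
    simp only [hP]
    unfold secondOrderTerm
    fun_prop
  set E : ℂ → ℂ := fun s => h s - (1 + ε * (s ^ 3 / 6 + r * s) + P s) with hE
  have hEd : Differentiable ℂ E := hhd.fun_sub (by fun_prop)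
  have hGd : Differentiable ℂ fun s : ℂ => Complex.exp (s ^ 2 / 2) := by fun_prop
  have hmom := iteratedDeriv_mean_cexp k ⌊x⌋₊ fun n =>
    ((ArithmeticFunction.cardDistinctFactors n : ℝ) - L - T) * ε
  have hfun : (fun s : ℂ => (∑ n ∈ Icc 1 ⌊x⌋₊, Complex.exp (s *
        ((((ArithmeticFunction.cardDistinctFactors n : ℝ) - L - T) * ε : ℝ) : ℂ))) / (⌊x⌋₊ : ℂ)) =
      fun s => (Complex.exp (s ^ 2 / 2) + (ε / 6 * (Complex.exp (s ^ 2 / 2) * s ^ 3) +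
        ε * r * (Complex.exp (s ^ 2 / 2) * s))) +
        (Complex.exp (s ^ 2 / 2) * P s + Complex.exp (s ^ 2 / 2) * E s) := by
    ext s
    rw [← cexp_mul_normalizedGenFun_eq hL hLε s]
    simp only [hE, hh]
    ring
  rw [hfun, iteratedDeriv_add_of_differentiable (by fun_prop) (by fun_prop),
    iteratedDeriv_add_of_differentiable (by fun_prop) (by fun_prop),
    iteratedDeriv_add_of_differentiable (by fun_prop) (by fun_prop),
    iteratedDeriv_add_of_differentiable (by fun_prop) (by fun_prop),
    iteratedDeriv_const_mul_field, iteratedDeriv_const_mul_field, iteratedDeriv_cexp_mul_cube hk,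
    iteratedDeriv_cexp_mul_id hk, iteratedDeriv_cexp_sq_div_two] at hmom
  have hPn := norm_iteratedDeriv_cexp_mul_le hPd hk fun s hs => (hr s hs).1
  have hEn := norm_iteratedDeriv_cexp_mul_le hEd hk fun s hs => (hr s hs).2
  -- The second-order term contains only even powers of s; this is the gain for odd k.
  have hPz : Odd k → iteratedDeriv k (fun s => Complex.exp (s ^ 2 / 2) * P s) 0 = 0 := fun hodd =>
    iteratedDeriv_eq_zero_of_even (fun s => by
      simp only [hP, secondOrderTerm]
      ring_nf) hodd
  have hMk := momentScale_pos k
  have hτA : τ ≤ √(A ^ 3) := by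
    refine Real.le_sqrt_of_sq_le ?_
    rw [hτ2, div_le_iff₀ hL0]
    exact hkA
  rw [meanUpTo]
  rw [← Real.norm_eq_abs, ← Complex.norm_real, Complex.ofReal_sub, ← hmom]
  have e : ∀ p q : ℂ, (gaussianMoment k : ℂ) + (ε / 6 * ((k * (k - 1) * gaussianMoment (k - 1) : ℝ) : ℂ) +
      ε * r * ((k * gaussianMoment (k - 1) : ℝ) : ℂ)) + (p + q) -
      ((gaussianMoment k + ((k : ℝ) * (k - 1) / 6 + k * r) * (gaussianMoment (k - 1) * ε) : ℝ) : ℂ) =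
      p + q := fun p q => by
    push_cast
    ring
  rw [e]
  split_ifs with hodd
  · rw [hPz hodd, zero_add]
    refine hEn.trans ?_
    have h1 : 0 ≤ 2 * C * √(A ^ 3) * (momentScale k * τ ^ 3) := by positivity
    linarith
  · refine (norm_add_le_of_le hPn hEn).trans ?_
    have h1 : τ ^ 3 ≤ √(A ^ 3) * τ ^ 2 := by
      rw [pow_succ']
      gcongr
    have h2 := mul_le_mul_of_nonneg_left h1 (show 0 ≤ 2 * C * momentScale k by positivity)
    linarith

/-! ### Bounded L and the conclusion -/

/-- The left side is the k-th derivative of s e^(s²/2) at 0, so the circle bound applies with F(s) =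
s and S = 2√(2k). -/
theorem mul_gaussianMoment_pred_le {k : ℕ} (hk : 1 ≤ k) :
    k * gaussianMoment (k - 1) ≤ 4 * √(2 * k) * momentScale k := by
  have h := norm_iteratedDeriv_cexp_mul_le (F := fun s => s) differentiable_id hk
    (S := 2 * √(2 * k)) fun s hs => hs.le
  rw [iteratedDeriv_cexp_mul_id hk, Complex.norm_real, Real.norm_eq_abs] at h
  linarith [le_abs_self (k * gaussianMoment (k - 1))]

theorem rpow_one_add_ite_odd_eq {y : ℝ} (hy : 0 ≤ y) (k : ℕ) :
    y ^ ((1 : ℝ) + (if Odd k then (1 : ℝ) else 0) / 2) = √y ^ (if Odd k then 3 else 2) := by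
  rw [Real.sqrt_eq_rpow, ← Real.rpow_natCast, ← Real.rpow_mul hy]
  congr 1
  split_ifs <;> norm_num

theorem abs_meanUpTo_le {x D : ℝ} {f : ℕ → ℝ} (hD : 0 ≤ D)
    (hf : ∀ n ∈ Icc 1 ⌊x⌋₊, |f n| ≤ D) : |meanUpTo x f| ≤ D := by
  rw [meanUpTo, abs_div, Nat.abs_cast]
  refine div_le_of_le_mul₀ (by positivity) hD ((abs_sum_le_sum_abs _ _).trans ?_)
  refine (sum_le_card_nsmul _ _ D hf).trans (le_of_eq ?_)
  rw [Nat.card_Icc, nsmul_eq_mul, mul_comm]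
  simp

theorem cardDistinctFactors_le_self (n : ℕ) : ArithmeticFunction.cardDistinctFactors n ≤ n := by
  rw [cardDistinctFactors_eq_card_primeFactors]
  calc n.primeFactors.card ≤ (Icc 1 n).card := card_le_card fun p hp =>
        mem_Icc.2 ⟨(Nat.prime_of_mem_primeFactors hp).one_le, Nat.le_of_mem_primeFactors hp⟩
    _ = n := by simp

/-- When L ≤ L₀, both x and k are bounded and L ≥ log log 3 > 0. So the left side is at most a
constant times M_k, while M_k and k³/L are bounded below. -/
theorem exists_abs_moment_sub_le_of_small (A L₀ : ℝ) (hA : 0 < A) :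
    ∃ C : ℝ, 0 < C ∧ ∀ (x T L ε : ℝ) (k : ℕ), L = Real.log (Real.log x) → 3 ≤ x →
      1 ≤ k → |T| ≤ A → L ≤ L₀ → (k : ℝ) ^ 3 ≤ A ^ 3 * L → 0 < ε → L * ε ^ 2 = 1 →
      |meanUpTo x (fun n =>
          (((ArithmeticFunction.cardDistinctFactors n : ℝ) - L - T) * ε) ^ k) -
        (gaussianMoment k + ((k : ℝ) * (k - 1) / 6 + k * (meisselMertens - T)) *
            (gaussianMoment (k - 1) * ε))| ≤
        C * (momentScale k * √(k ^ 3 / L) ^ (if Odd k then 3 else 2)) := by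
  set l : ℝ := Real.log (Real.log 3) with hl
  have hlog3 : 1 < Real.log 3 := by
    rw [Real.lt_log_iff_exp_lt (by norm_num)]
    linarith [Real.exp_one_lt_d9]
  have hl0 : 0 < l := Real.log_pos hlog3
  set L₁ : ℝ := max L₀ 1 with hL₁
  have hL₁1 : 1 ≤ L₁ := le_max_right _ _
  set K₀ : ℕ := ⌈A ^ 3 * L₁⌉₊ with hK₀
  set Y : ℝ := (Real.exp (Real.exp L₁) + L₁ + A) * (1 / √l) + 1 with hY
  have hY1 : 1 ≤ Y := by
    rw [hY]
    have : 0 ≤ (Real.exp (Real.exp L₁) + L₁ + A) * (1 / √l) := by positivity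
    linarith
  -- Only k ≤ K₀ occur, so the least M_k among them converts absolute constants into multiples of
  -- M_k.
  obtain ⟨k₀, -, hk₀⟩ := exists_min_image (range (K₀ + 1)) momentScale ⟨0, by simp⟩
  set m := momentScale k₀ with hm
  have hm0 : 0 < m := momentScale_pos k₀
  set D : ℝ := Y ^ K₀ / m + 1 +
    (K₀ + |meisselMertens| + A) * (4 * √(2 * K₀)) * (1 / √l) with hD
  have hD0 : 0 < D := by positivity
  refine ⟨D * L₁ ^ 2, by positivity, fun x T L ε k hL hx hk hT hLL₀ hkA hε hLε => ?_⟩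
  have hlogx : Real.log 3 ≤ Real.log x := Real.log_le_log (by norm_num) hx
  have hlL : l ≤ L := by rw [hL]; exact Real.log_le_log (by linarith) hlogx
  have hL0 : 0 < L := by linarith
  have hLL₁ : L ≤ L₁ := hLL₀.trans (le_max_left _ _)
  have hk1 : (1 : ℝ) ≤ k := by exact_mod_cast hk
  have hkK₀ : k ≤ K₀ := by
    have h1 : (k : ℝ) ≤ A ^ 3 * L₁ :=
      calc (k : ℝ) ≤ k ^ 3 := le_self_pow₀ hk1 (by norm_num)
        _ ≤ A ^ 3 * L := hkA
        _ ≤ A ^ 3 * L₁ := by gcongr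
    exact_mod_cast h1.trans (Nat.le_ceil _)
  have hkK₀' : (k : ℝ) ≤ K₀ := by exact_mod_cast hkK₀
  have hεl : ε ≤ 1 / √l := by
    rw [le_div_iff₀ (by positivity)]
    refine le_of_sq_le_sq ?_ (by norm_num)
    rw [mul_pow, Real.sq_sqrt hl0.le]
    nlinarith [sq_nonneg ε]
  have hM := momentScale_pos k
  have hmM : m ≤ momentScale k := hk₀ k (mem_range.2 (by omega))
  have hmean : |meanUpTo x (fun n =>
      (((ArithmeticFunction.cardDistinctFactors n : ℝ) - L - T) * ε) ^ k)| ≤ Y ^ K₀ := by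
    refine abs_meanUpTo_le (by positivity) fun n hn => ?_
    rw [abs_pow]
    refine (pow_le_pow_left₀ (abs_nonneg _) ?_ k).trans (pow_le_pow_right₀ hY1 hkK₀)
    have hn1 : (ArithmeticFunction.cardDistinctFactors n : ℝ) ≤ Real.exp (Real.exp L₁) := by
      calc (ArithmeticFunction.cardDistinctFactors n : ℝ) ≤ n := by
            exact_mod_cast cardDistinctFactors_le_self n
        _ ≤ x := (Nat.le_floor_iff (by linarith)).1 (mem_Icc.1 hn).2
        _ = Real.exp (Real.exp L) := by
            rw [hL, Real.exp_log (by linarith), Real.exp_log (by linarith)]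
        _ ≤ _ := Real.exp_le_exp.2 (Real.exp_le_exp.2 hLL₁)
    have hn2 : |(ArithmeticFunction.cardDistinctFactors n : ℝ) - L - T| ≤
        Real.exp (Real.exp L₁) + L₁ + A := by
      have h0 : (0 : ℝ) ≤ ArithmeticFunction.cardDistinctFactors n := by positivity
      have h1 := Real.exp_pos (Real.exp L₁)
      have h2 := abs_le.1 hT
      rw [abs_le]
      constructor <;> linarith [h2.1, h2.2]
    rw [abs_mul, abs_of_pos hε, hY]
    have := mul_le_mul hn2 hεl hε.le (by positivity)
    linarith
  have hgk := gaussianMoment_nonneg_and_le k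
  have hgk' := (gaussianMoment_nonneg_and_le (k - 1)).1
  have hsec : |((k : ℝ) * (k - 1) / 6 + k * (meisselMertens - T)) * (gaussianMoment (k - 1) * ε)| ≤
      (K₀ + |meisselMertens| + A) * (4 * √(2 * K₀)) * (1 / √l) * momentScale k := by
    have e : ((k : ℝ) * (k - 1) / 6 + k * (meisselMertens - T)) * (gaussianMoment (k - 1) * ε) =
        ((k - 1) / 6 + (meisselMertens - T)) * (k * gaussianMoment (k - 1)) * ε := by ring
    have h1 : |((k : ℝ) - 1) / 6 + (meisselMertens - T)| ≤ K₀ + |meisselMertens| + A := by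
      have h2 := abs_le.1 hT
      rw [abs_le]
      constructor <;>
        linarith [h2.1, h2.2, le_abs_self meisselMertens, neg_abs_le meisselMertens]
    have h2 : k * gaussianMoment (k - 1) ≤ 4 * √(2 * K₀) * momentScale k :=
      (mul_gaussianMoment_pred_le hk).trans (by gcongr)
    rw [e, abs_mul, abs_mul, abs_of_pos hε,
      abs_of_nonneg (show 0 ≤ k * gaussianMoment (k - 1) by positivity)]
    calc _ ≤ (K₀ + |meisselMertens| + A) * (4 * √(2 * K₀) * momentScale k) * (1 / √l) := by
          gcongr
      _ = _ := by ring
  have htotal : |meanUpTo x (fun n =>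
          (((ArithmeticFunction.cardDistinctFactors n : ℝ) - L - T) * ε) ^ k) -
        (gaussianMoment k + ((k : ℝ) * (k - 1) / 6 + k * (meisselMertens - T)) *
            (gaussianMoment (k - 1) * ε))| ≤ D * momentScale k := by
    have h1 : Y ^ K₀ ≤ Y ^ K₀ / m * momentScale k := by
      rw [div_mul_eq_mul_div, le_div_iff₀ hm0]
      gcongr
    have h2 := abs_le.1 hmean
    have h3 := abs_le.1 hsec
    rw [hD, add_mul, add_mul, abs_le]
    constructor <;> linarith [h2.1, h2.2, h3.1, h3.2, hgk.1, hgk.2]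
  have hone : 1 ≤ L₁ ^ 2 * √(k ^ 3 / L) ^ (if Odd k then 3 else 2) := by
    have h1 : 1 / L₁ ≤ k ^ 3 / L := by
      have : (1 : ℝ) ≤ k ^ 3 := one_le_pow₀ hk1
      gcongr
    have h2 : 1 / L₁ ≤ √(k ^ 3 / L) := by
      refine Real.le_sqrt_of_sq_le (le_trans ?_ h1)
      have : 1 / L₁ ≤ 1 := (div_le_one (by linarith)).2 hL₁1
      have : 0 ≤ 1 / L₁ := by positivity
      nlinarith
    have h3 : 1 / L₁ ≤ √(k ^ 3 / L) ^ 2 := by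
      rwa [Real.sq_sqrt (by positivity)]
    split_ifs
    · calc (1 : ℝ) = L₁ ^ 2 * (1 / L₁ * (1 / L₁)) := by field_simp
        _ ≤ L₁ ^ 2 * (√(k ^ 3 / L) ^ 2 * √(k ^ 3 / L)) := by gcongr
        _ = _ := by ring
    · calc (1 : ℝ) ≤ L₁ ^ 2 * (1 / L₁) := by
            rw [mul_one_div, sq, mul_div_assoc, div_self (by positivity)]
            linarith
        _ ≤ _ := by gcongr
  refine htotal.trans ?_
  have := mul_le_mul_of_nonneg_left hone (show 0 ≤ D * momentScale k by positivity)
  linarith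

/-- For large L, replacing the mean of ω by L + a costs K/log x ≤ K/L per unit of kμ_(k-1)ε, and
kμ_(k-1) is O(√k M_k). -/
theorem exists_abs_moment_sub_le (A : ℝ) (hA : 0 < A) :
    ∃ C : ℝ, 0 < C ∧ ∀ (x T L ε : ℝ) (k : ℕ), L = Real.log (Real.log x) → 3 ≤ x →
      1 ≤ k → |T| ≤ A → (k : ℝ) ^ 3 ≤ A ^ 3 * L → 0 < ε → L * ε ^ 2 = 1 →
      |meanUpTo x (fun n =>
          (((ArithmeticFunction.cardDistinctFactors n : ℝ) - L - T) * ε) ^ k) -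
        (gaussianMoment k + ((k : ℝ) * (k - 1) / 6 + k * (meisselMertens - T)) *
            (gaussianMoment (k - 1) * ε))| ≤
        C * (momentScale k * √(k ^ 3 / L) ^ (if Odd k then 3 else 2)) := by
  obtain ⟨C₁, L₀, hC₁, hL₀, hlarge⟩ := exists_abs_moment_sub_le_of_large A hA
  obtain ⟨C₂, hC₂, hsmall⟩ := exists_abs_moment_sub_le_of_small A L₀ hA
  obtain ⟨K, hK, hmean⟩ := exists_abs_mean_cardDistinctFactors_sub_le
  set C₃ : ℝ := K * (4 * √2) * (1 + √(A ^ 3)) with hC₃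
  refine ⟨C₁ + C₂ + C₃, by positivity, fun x T L ε k hL hx hk hT hkA hε hLε => ?_⟩
  have hM := momentScale_pos k
  set τ := √((k : ℝ) ^ 3 / L) with hτ
  have hτ0 : 0 ≤ τ := Real.sqrt_nonneg _
  rcases le_total L L₀ with hLL₀ | hLL₀
  · refine (hsmall x T L ε k hL hx hk hT hLL₀ hkA hε hLε).trans ?_
    gcongr
    have : 0 ≤ C₃ := by positivity
    linarith
  have hL0 : 0 < L := by linarith
  have hk1 : (1 : ℝ) ≤ k := by exact_mod_cast hk
  have hτ2 : τ ^ 2 = k ^ 3 / L := Real.sq_sqrt (by positivity)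
  have hmain := hlarge x T L ε τ k hL hx hk hT hLL₀ hkA hε hLε hτ0 hτ2
  set r := (∑ n ∈ Icc 1 ⌊x⌋₊, (ArithmeticFunction.cardDistinctFactors n : ℝ)) / ⌊x⌋₊ with hr
  have hr1 := hmean x hx
  rw [← hL] at hr1
  have hLx : L ≤ Real.log x := by
    rw [hL]
    have := Real.log_le_sub_one_of_pos (Real.log_pos (by linarith : 1 < x))
    linarith
  have hr2 : |r - L - meisselMertens| ≤ K / L :=
    hr1.trans (div_le_div_of_nonneg_left hK.le hL0 hLx)
  have hg := (gaussianMoment_nonneg_and_le (k - 1)).1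
  -- After squaring this is k/L³ ≤ k⁹/L³, so the correction fits even the odd-k error.
  have hετ : √k * ε / L ≤ τ ^ 3 := by
    refine le_of_sq_le_sq ?_ (by positivity)
    have h1 : ε ^ 2 = 1 / L := by field_simp; linarith
    have h2 : (√k * ε / L) ^ 2 = k / L ^ 3 := by
      rw [div_pow, mul_pow, Real.sq_sqrt (by positivity), h1]
      field_simp
    have h3 : (τ ^ 3) ^ 2 = k ^ 9 / L ^ 3 := by
      rw [← pow_mul, mul_comm 3 2, pow_mul, hτ2, div_pow]
      ring
    rw [h2, h3]
    gcongr
    exact le_self_pow₀ hk1 (by norm_num)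
  have hτA : τ ≤ √(A ^ 3) := Real.sqrt_le_sqrt (by rw [div_le_iff₀ hL0]; exact hkA)
  have hτpow : τ ^ 3 ≤ (1 + √(A ^ 3)) * τ ^ (if Odd k then 3 else 2) := by
    split_ifs
    · have : 0 ≤ √(A ^ 3) * τ ^ 3 := by positivity
      linarith
    · have : τ * τ ^ 2 ≤ √(A ^ 3) * τ ^ 2 := by gcongr
      nlinarith [sq_nonneg τ]
  have hcorr : |k * (r - L - meisselMertens) * (gaussianMoment (k - 1) * ε)| ≤
      C₃ * (momentScale k * τ ^ (if Odd k then 3 else 2)) := by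
    have e : k * (r - L - meisselMertens) * (gaussianMoment (k - 1) * ε) =
        (r - L - meisselMertens) * (k * gaussianMoment (k - 1)) * ε := by ring
    rw [e, abs_mul, abs_mul, abs_of_pos hε,
      abs_of_nonneg (show 0 ≤ k * gaussianMoment (k - 1) by positivity)]
    calc _ ≤ K / L * (4 * √(2 * k) * momentScale k) * ε := by
          have := mul_gaussianMoment_pred_le hk
          gcongr
      _ = K * (4 * √2) * momentScale k * (√k * ε / L) := by
          rw [Real.sqrt_mul (by norm_num)]
          ring
      _ ≤ K * (4 * √2) * momentScale k * ((1 + √(A ^ 3)) * τ ^ (if Odd k then 3 else 2)) := by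
          have := hετ.trans hτpow
          gcongr
      _ = _ := by rw [hC₃]; ring
  have h2 := abs_le.1 hmain
  have h3 := abs_le.1 hcorr
  have h4 : 0 ≤ C₂ * (momentScale k * τ ^ (if Odd k then 3 else 2)) := by positivity
  rw [add_mul, add_mul, abs_le]
  constructor <;> linarith [h2.1, h2.2, h3.1, h3.2]

theorem mainTheorem5 (A : ℝ) (hA : 0 < A) :
    ∃ C : ℝ, 0 < C ∧ ∀ (x : ℝ) (k : ℕ) (T : ℝ), 3 ≤ x → 1 ≤ k →
      (k : ℝ) ≤ A * (Real.log (Real.log x)) ^ ((1 : ℝ) / 3) → -A ≤ T → T ≤ A →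
      |meanUpTo x (fun n =>
            (((ArithmeticFunction.cardDistinctFactors n : ℝ) - Real.log (Real.log x) - T) /
              Real.sqrt (Real.log (Real.log x))) ^ k) -
          (gaussianMoment k +
            ((k : ℝ) * ((k : ℝ) - 1) / 6 + (k : ℝ) * (meisselMertens - T)) *
              (gaussianMoment (k - 1) / Real.sqrt (Real.log (Real.log x))))| ≤
        C * (momentScale k *
          ((k : ℝ) ^ 3 / Real.log (Real.log x)) ^
            ((1 : ℝ) + (if Odd k then (1 : ℝ) else 0) / 2)) := by
  obtain ⟨C, hC, h⟩ := exists_abs_moment_sub_le A hA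
  refine ⟨C, hC, fun x k T hx hk hkA hT1 hT2 => ?_⟩
  have hlogx : 1 < Real.log x := by
    rw [Real.lt_log_iff_exp_lt (by linarith)]
    linarith [Real.exp_one_lt_d9]
  set L := Real.log (Real.log x) with hL
  have hL0 : 0 < L := Real.log_pos hlogx
  have hkA3 : (k : ℝ) ^ 3 ≤ A ^ 3 * L := by
    calc (k : ℝ) ^ 3 ≤ (A * L ^ ((1 : ℝ) / 3)) ^ 3 := by gcongr
      _ = A ^ 3 * L := by
        rw [mul_pow, ← Real.rpow_natCast (L ^ _), ← Real.rpow_mul hL0.le]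
        norm_num
  have hmain := h x T L (√L)⁻¹ k hL hx hk (abs_le.2 ⟨hT1, hT2⟩) hkA3 (by positivity)
    (by rw [inv_pow, Real.sq_sqrt hL0.le, mul_inv_cancel₀ hL0.ne'])
  rw [rpow_one_add_ite_odd_eq (by positivity)]
  simpa only [div_eq_mul_inv] using hmain
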